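/- **Setting.** Let $e\neq 0$ be real (the elementary charge). Minkowski space has signature $(+,-,-,-)$, $l$ denotes nonzero future-pointing null vectors, $L_{ab}=l_a\partial_b-l_b\partial_a$, $\dot V=\partial_sV$, and $d^2l$ is the invariant measure on null directions, given on functions homogeneous of degree $-2$ by integration over $l=(1,\vec n)$, $\vec n\in S^2$, with the spherical angle measure. Let $\mathcal V$ be the real vector space of smooth vector-valued functions $V_a(s,l)$, homogeneous of degree $-1$ (i.e. $V_a(\mu s,\mu l)=\mu^{-1}V_a(s,l)$ for $\mu>0$), with $l\cdot V(s,l)=0$, $V(+\infty,l)=0$, $L_{[ab}V_{c]}(-\infty,l)=0$ and, for every $k\ge 0$ and some constants $C$ and $\epsilon>0$ depending on $V,k$, $|L_{b_1c_1}\cdots L_{b_kc_k}\dot V_a(s,l)|<C\,(t\cdot l)^{-2}(1+|s|/t\cdot l)^{-1-\epsilon}$, where $t=(1,0,0,0)$. Put $$\{V_1,V_2\}=\frac1{4\pi}\int(\dot V_1\cdot V_2-\dot V_2\cdot V_1)(s,l)\,ds\,d^2l,\qquad \Phi_V(l)=\frac1{4\pi}\int\frac{l\cdot V(-\infty,l')}{l\cdot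 l'}\,d^2l'.$$ Let $L=\mathcal V/\!\sim$ be the Abelian group of classes $(V)$, where $V_1\sim V_2$ iff $V_2-V_1=l\,\alpha(s,l)$ with $\frac1{4\pi}\int\alpha(-\infty,l)\,d^2l\in\frac{2\pi}e\mathbb Z$. For $c\in\mathbb R$, $(0,c \bmod 2\pi/e)\in L$ denotes the class of any $V\in\mathcal V$ of the form $l\,\alpha$ with $\frac1{4\pi}\int\alpha(-\infty,l)\,d^2l=c$. Let $\mathcal K$ be the Hilbert space of (classes of) $\mathbb C^4$-valued functions on the hyperboloid $v^2=1$, $v^0>0$ with scalar product $(f,g)=\int\overline{f(v)}\,\gamma\cdot v\,g(v)\,d^3v/v^0$ ($\gamma^a$ the Dirac matrices, the bar denoting Dirac conjugation), and let $(S_\Phi g)(v)=\exp\big(\frac{ie}{4\pi}\int\frac{\Phi(l)}{(v\cdot l)^2}\,d^2l\big)g(v)$. Let $\mathcal B$ be the unital complex $*$-algebra generated by elements $W(V)$, $(V)\in L$, and $B(g)$, $g\in\mathcal K$, with $B(g)$ antilinear in $g$, subject to $$W(V)^*=W(-V),\quad W(0)=1,\quad W(V_1)W(V_2)=e^{-\frac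 i2\{V_1,V_2\}}W(V_1+V_2),$$ $$B(f)B(g)+B(g)B(f)=0,\quad B(f)B(g)^*+B(g)^*B(f)=(f,g)1,\quad W(V)B(g)=B(S_{\Phi_V}g)W(V),$$ and let the field algebra $\mathcal F$ be the completion of $\mathcal B$ in the norm $\|A\|=\sup_pp(A)$, $p$ running over all $C^*$-norms on $\mathcal B$. Let $\pi$ be a unital $*$-representation of $\mathcal F$ by bounded operators on a complex Hilbert space $\mathcal H$. It is called a charge-representation if $c\mapsto\pi(W((0,c\bmod 2\pi/e)))$ is strongly continuous; its charge operator $Q_\pi$ is then the generator, $\pi(W((0,c\bmod 2\pi/e)))=e^{icQ_\pi}$. The same notions are used for the restrictions of $\pi$ to closed invariant subspaces. A subspace $S$ is called cyclic if the closed linear span of $\pi(\mathcal F)S$ is the whole representation space. **Proposition 4.1.** Let $\pi$ be a charge-representation of $\mathcal F$ on $\mathcal H$. Then $\mathcal H=\mathcal H_1\oplus\mathcal H_2\oplus\mathcal H_3$, an orthogonal sum of closed $\pi(\mathcal F)$-invariant subspaces (any of which may be zero), such that (i) either $\mathcal H_1=0$, or for the restriction of $\pi$ to $\mathcal H_1$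 every $ke$, $k\in\mathbb Z$, is an eigenvalue of the charge operator and its eigenspace is cyclic; (ii) for the restriction of $\pi$ to $\mathcal H_2$, the subspace of vectors $\psi$ with $\pi(B(g))\psi=0$ for all $g\in\mathcal K$ is cyclic; (iii) for the restriction of $\pi$ to $\mathcal H_3$, the subspace of vectors $\psi$ with $\pi(B(g)^*)\psi=0$ for all $g\in\mathcal K$ is cyclic. -/

import Mathlib

namespace AsympField
noncomputable section
open MeasureTheory Filter Topology Set
open scoped ContDiff

section Minkowski

/-- Minkowski space, by contravariant components `x⁰, x¹, x², x³`. -/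
abbrev Spacetime : Type := Fin 4 → ℝ

/-- Diagonal entries of the metric of signature `(+,-,-,-)`. -/
def eta (a : Fin 4) : ℝ := if a = 0 then 1 else -1

/-- The Minkowski product `x · y`. -/
def mink (x y : Spacetime) : ℝ := ∑ a, eta a * x a * y a

/-- Nonzero future-pointing null vectors. -/
def lightCone : Set Spacetime := {l | mink l l = 0 ∧ 0 < l 0}

/-- Length of the spatial part. -/
def rad (x : Spacetime) : ℝ := √(x 1 ^ 2 + x 2 ^ 2 + x 3 ^ 2)

/-- The point of the light cone with the same spatial part as `x`. -/
def retr (x : Spacetime) : Spacetime := Function.update x 0 (rad x)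

/-- The vector `l_a e_b - l_b e_a` (with lowered components `l_a`). -/
def tangentDir (a b : Fin 4) (l : Spacetime) : Spacetime :=
  (eta a * l a) • Pi.single b (1 : ℝ) - (eta b * l b) • Pi.single a (1 : ℝ)

/-- The operator `L_ab = l_a ∂_b - l_b ∂_a` on functions on the light cone. It differentiates in a
direction tangent to the cone, so any extension of `f` off the cone may be used; here the extension
`f ∘ retr` is taken, so that only the values of `f` on the cone matter. -/
def angular (a b : Fin 4) (f : Spacetime → ℝ) (l : Spacetime) : ℝ :=
  fderiv ℝ (fun x => f (retr x)) l (tangentDir a b l)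

/-- The product `L_{b₁c₁} ⋯ L_{b_k c_k}` applied to a function on the light cone. -/
def angularIter (w : List (Fin 4 × Fin 4)) (f : Spacetime → ℝ) : Spacetime → ℝ :=
  w.foldr (fun p g => angular p.1 p.2 g) f

theorem mink_expand (x y : Spacetime) : mink x y = x 0 * y 0 - x 1 * y 1 - x 2 * y 2 - x 3 * y 3 := by
  simp [mink, eta, Fin.sum_univ_four]; ring

theorem mink_add_right (x y z : Spacetime) : mink x (y + z) = mink x y + mink x z := by
  simp only [mink_expand, Pi.add_apply]; ring

theorem mink_smul_right (c : ℝ) (x y : Spacetime) : mink x (c • y) = c * mink x y := by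
  simp only [mink_expand, Pi.smul_apply, smul_eq_mul]; ring

theorem mink_smul_left (c : ℝ) (x y : Spacetime) : mink (c • x) y = c * mink x y := by
  simp only [mink_expand, Pi.smul_apply, smul_eq_mul]; ring

theorem mink_comm (x y : Spacetime) : mink x y = mink y x := by
  simp only [mink_expand]; ring

theorem smul_mem_lightCone {μ : ℝ} (hμ : 0 < μ) {l : Spacetime} (hl : l ∈ lightCone) :
    μ • l ∈ lightCone := by
  refine ⟨?_, ?_⟩
  · rw [mink_smul_left, mink_smul_right, hl.1]; simp
  · simpa using mul_pos hμ hl.2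

theorem rad_eq_of_mem {l : Spacetime} (hl : l ∈ lightCone) : rad l = l 0 := by
  have h := hl.1
  rw [mink_expand] at h
  rw [rad, show l 1 ^ 2 + l 2 ^ 2 + l 3 ^ 2 = l 0 ^ 2 by linarith, Real.sqrt_sq hl.2.le]

/-- Vectors with nonzero spatial part. -/
def offAxis : Set Spacetime := {x | 0 < x 1 ^ 2 + x 2 ^ 2 + x 3 ^ 2}

theorem isOpen_offAxis : IsOpen offAxis := isOpen_lt continuous_const (by fun_prop)

theorem lightCone_subset : lightCone ⊆ offAxis := fun l hl => by
  have h := hl.1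
  rw [mink_expand] at h
  change 0 < l 1 ^ 2 + l 2 ^ 2 + l 3 ^ 2
  nlinarith [hl.2]

theorem retr_of_mem {l : Spacetime} (hl : l ∈ lightCone) : retr l = l := by
  rw [retr, rad_eq_of_mem hl, Function.update_eq_self]

theorem retr_mem {x : Spacetime} (hx : x ∈ offAxis) : retr x ∈ lightCone := by
  have h : rad x ^ 2 = x 1 ^ 2 + x 2 ^ 2 + x 3 ^ 2 := Real.sq_sqrt (le_of_lt hx)
  refine ⟨?_, ?_⟩
  · rw [mink_expand]; simp [retr]; nlinarith
  · simp only [retr, Function.update_self]; exact Real.sqrt_pos.mpr hx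

theorem contDiffOn_rad : ContDiffOn ℝ ∞ rad offAxis := by
  intro x hx
  refine ContDiffWithinAt.sqrt ?_ (ne_of_gt hx)
  exact ContDiff.contDiffWithinAt (by fun_prop)

theorem contDiffOn_retr : ContDiffOn ℝ ∞ retr offAxis := by
  rw [contDiffOn_pi]
  intro i
  by_cases hi : i = 0
  · subst hi
    simpa [retr] using contDiffOn_rad
  · have : (fun x : Spacetime => retr x i) = fun x => x i := by
      ext x; simp [retr, hi]
    rw [this]
    exact ContDiff.contDiffOn (by fun_prop)

theorem smul_mem_offAxis {μ : ℝ} (hμ : 0 < μ) {x : Spacetime} (hx : x ∈ offAxis) : μ • x ∈ offAxis := by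
  have h : 0 < x 1 ^ 2 + x 2 ^ 2 + x 3 ^ 2 := hx
  change 0 < (μ • x) 1 ^ 2 + (μ • x) 2 ^ 2 + (μ • x) 3 ^ 2
  simp only [Pi.smul_apply, smul_eq_mul]
  have : 0 < μ ^ 2 * (x 1 ^ 2 + x 2 ^ 2 + x 3 ^ 2) := by positivity
  nlinarith

theorem retr_smul {μ : ℝ} (hμ : 0 < μ) (x : Spacetime) : retr (μ • x) = μ • retr x := by
  have : rad (μ • x) = μ * rad x := by
    simp only [rad, Pi.smul_apply, smul_eq_mul]
    rw [show (μ * x 1) ^ 2 + (μ * x 2) ^ 2 + (μ * x 3) ^ 2 =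
      μ ^ 2 * (x 1 ^ 2 + x 2 ^ 2 + x 3 ^ 2) by ring, Real.sqrt_mul (sq_nonneg μ), Real.sqrt_sq hμ.le]
  ext i
  by_cases hi : i = 0
  · subst hi; simp [retr, this]
  · simp [retr, hi]

theorem comp_retr {E : Type*} [NormedAddCommGroup E] [NormedSpace ℝ E] {f : Spacetime → E}
    (hf : ContDiffOn ℝ ∞ f lightCone) : ContDiffOn ℝ ∞ (fun x => f (retr x)) offAxis :=
  ContDiffOn.comp hf contDiffOn_retr fun _ hx => retr_mem hx

theorem comp_retr₂ {E : Type*} [NormedAddCommGroup E] [NormedSpace ℝ E]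
    {F : ℝ → Spacetime → E} (hF : ContDiffOn ℝ ∞ (fun p : ℝ × Spacetime => F p.1 p.2) (univ ×ˢ lightCone)) :
    ContDiffOn ℝ ∞ (fun p : ℝ × Spacetime => F p.1 (retr p.2)) (univ ×ˢ offAxis) :=
  ContDiffOn.comp (g := fun p : ℝ × Spacetime => F p.1 p.2) hF
    (contDiffOn_fst.prodMk (contDiffOn_retr.comp contDiffOn_snd fun _ hp => hp.2))
    fun _ hp => ⟨mem_univ _, retr_mem hp.2⟩

theorem isOpen_strip : IsOpen ((univ : Set ℝ) ×ˢ offAxis) := isOpen_univ.prod isOpen_offAxis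

/-- `L_ab` preserves joint smoothness. -/
theorem contDiffOn_angular₂ {F : ℝ → Spacetime → ℝ}
    (hF : ContDiffOn ℝ ∞ (fun p : ℝ × Spacetime => F p.1 p.2) (univ ×ˢ lightCone)) (a b : Fin 4) :
    ContDiffOn ℝ ∞ (fun p : ℝ × Spacetime => angular a b (F p.1) p.2) (univ ×ˢ offAxis) := by
  have h := comp_retr₂ hF
  intro p hp
  refine ContDiffAt.contDiffWithinAt ?_
  have h1 : ContDiffAt ℝ ∞ (fun q : (ℝ × Spacetime) × Spacetime => F q.1.1 (retr q.2)) (p, p.2) := by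
    have h2 : ContDiffAt ℝ ∞ (fun q : ℝ × Spacetime => F q.1 (retr q.2)) (p.1, p.2) :=
      h.contDiffAt (isOpen_strip.mem_nhds hp)
    exact ContDiffAt.comp (p, p.2) (g := fun q : ℝ × Spacetime => F q.1 (retr q.2))
      (f := fun q : (ℝ × Spacetime) × Spacetime => (q.1.1, q.2)) h2 (ContDiff.contDiffAt (by fun_prop))
  have h3 := ContDiffAt.fderiv (f := fun (q : ℝ × Spacetime) (x : Spacetime) => F q.1 (retr x))
    (g := fun q : ℝ × Spacetime => q.2) (m := ∞) (n := ∞) (x₀ := p) h1 contDiffAt_snd (by simp)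
  refine h3.clm_apply (ContDiff.contDiffAt ?_)
  unfold tangentDir
  fun_prop

theorem contDiffOn_angularIter₂ {F : ℝ → Spacetime → ℝ}
    (hF : ContDiffOn ℝ ∞ (fun p : ℝ × Spacetime => F p.1 p.2) (univ ×ˢ lightCone))
    (w : List (Fin 4 × Fin 4)) :
    ContDiffOn ℝ ∞ (fun p : ℝ × Spacetime => angularIter w (F p.1) p.2) (univ ×ˢ lightCone) := by
  induction w with
  | nil => exact hF
  | cons ab w ih =>
    exact (contDiffOn_angular₂ (F := fun s => angularIter w (F s)) ih ab.1 ab.2).mono (prod_mono_right lightCone_subset)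

theorem contDiffOn_angularIter {f : Spacetime → ℝ} (hf : ContDiffOn ℝ ∞ f lightCone)
    (w : List (Fin 4 × Fin 4)) : ContDiffOn ℝ ∞ (angularIter w f) lightCone := by
  have h := contDiffOn_angularIter₂ (F := fun _ : ℝ => f)
    (hf.comp contDiffOn_snd fun _ hp => hp.2) w
  exact h.comp (f := fun l : Spacetime => ((0 : ℝ), l)) (ContDiff.contDiffOn (by fun_prop))
    fun _ hl => ⟨mem_univ _, hl⟩

theorem angular_congr {f g : Spacetime → ℝ} (h : EqOn f g lightCone) (a b : Fin 4) :
    EqOn (angular a b f) (angular a b g) lightCone := by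
  intro l hl
  have : (fun x => f (retr x)) =ᶠ[𝓝 l] fun x => g (retr x) := by
    filter_upwards [isOpen_offAxis.mem_nhds (lightCone_subset hl)] with x hx
    exact h (retr_mem hx)
  simp only [angular, this.fderiv_eq]

theorem angularIter_congr {f g : Spacetime → ℝ} (h : EqOn f g lightCone) (w : List (Fin 4 × Fin 4)) :
    EqOn (angularIter w f) (angularIter w g) lightCone := by
  induction w with
  | nil => exact h
  | cons ab w ih => exact angular_congr ih ab.1 ab.2

theorem differentiableAt_comp_retr {f : Spacetime → ℝ} (hf : ContDiffOn ℝ ∞ f lightCone) {l : Spacetime}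
    (hl : l ∈ lightCone) : DifferentiableAt ℝ (fun x => f (retr x)) l :=
  ((comp_retr hf).contDiffAt
    (isOpen_offAxis.mem_nhds (lightCone_subset hl))).differentiableAt (by simp)

theorem angular_add {f g : Spacetime → ℝ} (hf : ContDiffOn ℝ ∞ f lightCone)
    (hg : ContDiffOn ℝ ∞ g lightCone) (a b : Fin 4) {l : Spacetime} (hl : l ∈ lightCone) :
    angular a b (f + g) l = angular a b f l + angular a b g l := by
  have := fderiv_add (differentiableAt_comp_retr hf hl) (differentiableAt_comp_retr hg hl)
  have h2 : (fun x => (f + g) (retr x)) = (fun x => f (retr x)) + fun x => g (retr x) := rfl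
  simp only [angular, h2, this, add_apply]

theorem angular_smul (c : ℝ) {f : Spacetime → ℝ} (hf : ContDiffOn ℝ ∞ f lightCone)
    (a b : Fin 4) {l : Spacetime} (hl : l ∈ lightCone) :
    angular a b (c • f) l = c * angular a b f l := by
  have := fderiv_const_smul (differentiableAt_comp_retr hf hl) c
  have h2 : (fun x => (c • f) (retr x)) = c • fun x => f (retr x) := rfl
  simp only [angular, h2, this, smul_apply, smul_eq_mul]

theorem angularIter_add {f g : Spacetime → ℝ} (hf : ContDiffOn ℝ ∞ f lightCone)
    (hg : ContDiffOn ℝ ∞ g lightCone) (w : List (Fin 4 × Fin 4)) :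
    EqOn (angularIter w (f + g)) (angularIter w f + angularIter w g) lightCone := by
  induction w with
  | nil => exact fun _ _ => rfl
  | cons ab w ih =>
    intro l hl
    refine (angular_congr ih ab.1 ab.2 hl).trans ?_
    exact angular_add (contDiffOn_angularIter hf w) (contDiffOn_angularIter hg w) _ _ hl

theorem angularIter_smul (c : ℝ) {f : Spacetime → ℝ} (hf : ContDiffOn ℝ ∞ f lightCone)
    (w : List (Fin 4 × Fin 4)) :
    EqOn (angularIter w (c • f)) (c • angularIter w f) lightCone := by
  induction w with
  | nil => exact fun _ _ => rfl
  | cons ab w ih =>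
    intro l hl
    refine (angular_congr ih ab.1 ab.2 hl).trans ?_
    exact angular_smul c (contDiffOn_angularIter hf w) _ _ hl

theorem angularIter_zero (w : List (Fin 4 × Fin 4)) : angularIter w 0 = 0 := by
  induction w with
  | nil => rfl
  | cons ab w ih =>
    change angular ab.1 ab.2 (angularIter w 0) = 0
    rw [ih]
    ext l
    simp [angular]

theorem mink_tangentDir (a b : Fin 4) (l : Spacetime) : mink l (tangentDir a b l) = 0 := by
  rw [mink_expand]
  simp only [tangentDir, Pi.sub_apply, Pi.smul_apply, smul_eq_mul]
  fin_cases a <;> fin_cases b <;> simp [eta] <;> ring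

theorem hasFDerivAt_rad {l : Spacetime} (hl : l ∈ lightCone) : ∃ R : Spacetime →L[ℝ] ℝ, HasFDerivAt rad R l ∧
    ∀ v, mink l v = 0 → R v = v 0 := by
  have hl0 : l 0 ≠ 0 := hl.2.ne'
  have h1 := (((hasFDerivAt_apply (𝕜 := ℝ) (1 : Fin 4) l).pow 2).add
    ((hasFDerivAt_apply (𝕜 := ℝ) (2 : Fin 4) l).pow 2)).add
    ((hasFDerivAt_apply (𝕜 := ℝ) (3 : Fin 4) l).pow 2)
  refine ⟨_, h1.sqrt (ne_of_gt (lightCone_subset hl)), fun v hv => ?_⟩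
  have hr := rad_eq_of_mem hl
  simp only [rad] at hr
  rw [mink_expand] at hv
  simp [hr]
  field_simp
  linarith

/-- Evaluation of `L_ab f` through an arbitrary extension of `f`. -/
theorem angular_eq_of_hasFDerivAt {f : Spacetime → ℝ} {f' : Spacetime →L[ℝ] ℝ} {l : Spacetime} (hf : HasFDerivAt f f' l)
    (hl : l ∈ lightCone) (a b : Fin 4) : angular a b f l = f' (tangentDir a b l) := by
  obtain ⟨R, hR, hR0⟩ := hasFDerivAt_rad hl
  have h1 : HasFDerivAt retr (ContinuousLinearMap.pi fun i : Fin 4 =>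
      if i = 0 then R else ContinuousLinearMap.proj (R := ℝ) i) l := by
    rw [hasFDerivAt_pi']
    intro i
    by_cases hi : i = 0
    · subst hi
      have : (fun x : Spacetime => retr x 0) = rad := by ext x; simp [retr]
      rw [this]
      exact hR.congr_fderiv (by ext; simp)
    · have : (fun x : Spacetime => retr x i) = fun x => x i := by ext x; simp [retr, hi]
      rw [this]
      exact (hasFDerivAt_apply (𝕜 := ℝ) i l).congr_fderiv (by ext; simp [hi])
  rw [← retr_of_mem hl] at hf
  have h2 := HasFDerivAt.comp l hf h1
  have h3 : fderiv ℝ (fun x => f (retr x)) l = _ := h2.fderiv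
  rw [angular, h3, ContinuousLinearMap.comp_apply]
  congr 1
  ext i
  by_cases hi : i = 0
  · subst hi; simp [hR0 _ (mink_tangentDir a b l)]
  · simp [hi]

end Minkowski

section TestFields

/-- The derivative `V̇` with respect to the first variable. -/
def dotV (V : ℝ → Spacetime → Spacetime) (s : ℝ) (l : Spacetime) : Spacetime := deriv (fun u => V u l) s

/-- The limit function `V (-∞, l)`. -/
def pastLimit (V : ℝ → Spacetime → Spacetime) (l : Spacetime) : Spacetime := limUnder atBot fun s => V s l

/-- The conditions on a test field `V^a (s, l)`. A function on the cone is represented by its extension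
by zero. The bounds on the derivatives, stated in the frame `t = (1,0,0,0)`, where `t · l = l 0`, imply
existence, smoothness and homogeneity of the limit function at `s → -∞`; existence and smoothness are
recorded for convenience. There are finitely many words of each length and finitely many components,
so the constants may be taken to depend on the length only. -/
structure IsTestField (V : ℝ → Spacetime → Spacetime) : Prop where
  zero_off : ∀ s, ∀ l ∉ lightCone, V s l = 0
  smooth : ContDiffOn ℝ ∞ (fun p : ℝ × Spacetime => V p.1 p.2) (univ ×ˢ lightCone)
  homogeneous : ∀ μ : ℝ, 0 < μ → ∀ s, ∀ l ∈ lightCone, V (μ * s) (μ • l) = μ⁻¹ • V s l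
  transversal : ∀ s, ∀ l ∈ lightCone, mink l (V s l) = 0
  decay : ∀ (w : List (Fin 4 × Fin 4)) (a : Fin 4), ∃ C ε : ℝ, 0 < ε ∧ ∀ s, ∀ l ∈ lightCone,
    |angularIter w (fun l' => dotV V s l' a) l| < C / (l 0 ^ 2 * (1 + |s| / l 0) ^ (1 + ε))
  future_limit : ∀ l ∈ lightCone, Tendsto (fun s => V s l) atTop (𝓝 0)
  past_limit : ∀ l ∈ lightCone, Tendsto (fun s => V s l) atBot (𝓝 (pastLimit V l))
  past_smooth : ContDiffOn ℝ ∞ (pastLimit V) lightCone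
  past_curl : ∀ a b c, ∀ l ∈ lightCone,
    angular a b (fun l' => eta c * pastLimit V l' c) l +
    angular b c (fun l' => eta a * pastLimit V l' a) l +
    angular c a (fun l' => eta b * pastLimit V l' b) l = 0

theorem contDiffOn_dotV {V : ℝ → Spacetime → Spacetime}
    (hV : ContDiffOn ℝ ∞ (fun p : ℝ × Spacetime => V p.1 p.2) (univ ×ˢ lightCone)) :
    ContDiffOn ℝ ∞ (fun p : ℝ × Spacetime => dotV V p.1 p.2) (univ ×ˢ lightCone) := by
  have h := comp_retr₂ hV
  have key : ContDiffOn ℝ ∞ (fun p : ℝ × Spacetime => deriv (fun u => V u (retr p.2)) p.1)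
      (univ ×ˢ offAxis) := by
    intro p hp
    refine ContDiffAt.contDiffWithinAt ?_
    have h1 : ContDiffAt ℝ ∞ (fun q : (ℝ × Spacetime) × ℝ => V q.2 (retr q.1.2)) (p, p.1) := by
      have h2 : ContDiffAt ℝ ∞ (fun q : ℝ × Spacetime => V q.1 (retr q.2)) (p.1, p.2) :=
        h.contDiffAt (isOpen_strip.mem_nhds hp)
      exact ContDiffAt.comp (p, p.1) (g := fun q : ℝ × Spacetime => V q.1 (retr q.2))
        (f := fun q : (ℝ × Spacetime) × ℝ => (q.2, q.1.2)) h2 (ContDiff.contDiffAt (by fun_prop))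
    have h3 := ContDiffAt.fderiv (f := fun (q : ℝ × Spacetime) (u : ℝ) => V u (retr q.2))
      (g := fun q : ℝ × Spacetime => q.1) (m := ∞) (n := ∞) (x₀ := p) h1 contDiffAt_fst (by simp)
    exact h3.clm_apply contDiffAt_const
  refine (key.mono (prod_mono_right lightCone_subset)).congr ?_
  intro p hp
  simp only [dotV, retr_of_mem hp.2]

theorem contDiffOn_slice {E : Type*} [NormedAddCommGroup E] [NormedSpace ℝ E] {F : ℝ → Spacetime → E}
    (hF : ContDiffOn ℝ ∞ (fun p : ℝ × Spacetime => F p.1 p.2) (univ ×ˢ lightCone)) (s : ℝ) :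
    ContDiffOn ℝ ∞ (F s) lightCone :=
  hF.comp (f := fun l : Spacetime => (s, l)) (ContDiff.contDiffOn (by fun_prop))
    fun _ hl => ⟨mem_univ _, hl⟩

theorem differentiable_time {V : ℝ → Spacetime → Spacetime}
    (hV : ContDiffOn ℝ ∞ (fun p : ℝ × Spacetime => V p.1 p.2) (univ ×ˢ lightCone)) {l : Spacetime}
    (hl : l ∈ lightCone) : Differentiable ℝ fun u => V u l := by
  have h : ContDiffOn ℝ ∞ (fun u : ℝ => V u l) univ :=
    hV.comp (f := fun u : ℝ => (u, l)) (ContDiff.contDiffOn (by fun_prop))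
      fun _ _ => ⟨mem_univ _, hl⟩
  exact (contDiffOn_univ.mp h).differentiable (by simp)

namespace IsTestField
variable {V W : ℝ → Spacetime → Spacetime}

theorem contDiffOn_dot_apply (hV : IsTestField V) (s : ℝ) (a : Fin 4) :
    ContDiffOn ℝ ∞ (fun l => dotV V s l a) lightCone :=
  contDiffOn_pi.mp (contDiffOn_slice (contDiffOn_dotV hV.smooth) s) a

theorem pastLimit_add (hV : IsTestField V) (hW : IsTestField W) {l : Spacetime} (hl : l ∈ lightCone) :
    pastLimit (V + W) l = pastLimit V l + pastLimit W l :=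
  ((hV.past_limit l hl).add (hW.past_limit l hl)).limUnder_eq

theorem pastLimit_smul (hV : IsTestField V) (c : ℝ) {l : Spacetime} (hl : l ∈ lightCone) :
    pastLimit (c • V) l = c • pastLimit V l :=
  ((hV.past_limit l hl).const_smul c).limUnder_eq

theorem contDiffOn_past_apply (hV : IsTestField V) (c : Fin 4) :
    ContDiffOn ℝ ∞ (fun l => eta c * pastLimit V l c) lightCone :=
  contDiffOn_const.mul (contDiffOn_pi.mp hV.past_smooth c)

theorem add (hV : IsTestField V) (hW : IsTestField W) : IsTestField (V + W) where
  zero_off s l hl := by simp [hV.zero_off s l hl, hW.zero_off s l hl]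
  smooth := hV.smooth.add hW.smooth
  homogeneous μ hμ s l hl := by
    simp [hV.homogeneous μ hμ s l hl, hW.homogeneous μ hμ s l hl]
  transversal s l hl := by
    simp [mink_add_right, hV.transversal s l hl, hW.transversal s l hl]
  decay w a := by
    obtain ⟨C₁, ε₁, h₁, H₁⟩ := hV.decay w a
    obtain ⟨C₂, ε₂, h₂, H₂⟩ := hW.decay w a
    refine ⟨C₁ + C₂, min ε₁ ε₂, lt_min h₁ h₂, fun s l hl => ?_⟩
    have e1 : EqOn (fun l' => dotV (V + W) s l' a)
        ((fun l' => dotV V s l' a) + fun l' => dotV W s l' a) lightCone := by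
      intro l' hl'
      have := deriv_add (differentiable_time hV.smooth hl' s) (differentiable_time hW.smooth hl' s)
      exact congrFun this a
    rw [angularIter_congr e1 w hl,
      angularIter_add (hV.contDiffOn_dot_apply s a) (hW.contDiffOn_dot_apply s a) w hl]
    have hl0 : 0 < l 0 := hl.2
    have key : ∀ {C ε x : ℝ}, min ε₁ ε₂ ≤ ε → |x| < C / (l 0 ^ 2 * (1 + |s| / l 0) ^ (1 + ε)) →
        |x| < C / (l 0 ^ 2 * (1 + |s| / l 0) ^ (1 + min ε₁ ε₂)) := by
      intro C ε x hε hx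
      have hC : 0 ≤ C := by
        by_contra hC
        have : C / (l 0 ^ 2 * (1 + |s| / l 0) ^ (1 + ε)) ≤ 0 :=
          div_nonpos_of_nonpos_of_nonneg (by linarith) (by positivity)
        linarith [abs_nonneg x]
      refine hx.trans_le (div_le_div_of_nonneg_left hC (by positivity) ?_)
      have hb : 0 ≤ |s| / l 0 := by positivity
      gcongr
      linarith
    calc _ ≤ |angularIter w (fun l' => dotV V s l' a) l| +
          |angularIter w (fun l' => dotV W s l' a) l| := abs_add_le _ _
      _ < _ := add_lt_add (key (min_le_left _ _) (H₁ s l hl)) (key (min_le_right _ _) (H₂ s l hl))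
      _ = _ := by rw [add_div]
  future_limit l hl := by simpa using (hV.future_limit l hl).add (hW.future_limit l hl)
  past_limit l hl := by
    rw [pastLimit_add hV hW hl]
    exact (hV.past_limit l hl).add (hW.past_limit l hl)
  past_smooth := (hV.past_smooth.add hW.past_smooth).congr fun _ hl => pastLimit_add hV hW hl
  past_curl a b c l hl := by
    have e : ∀ c, EqOn (fun l' => eta c * pastLimit (V + W) l' c)
        ((fun l' => eta c * pastLimit V l' c) + fun l' => eta c * pastLimit W l' c) lightCone := by
      intro c l' hl'
      simp [pastLimit_add hV hW hl', mul_add]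
    have f : ∀ a b c, angular a b (fun l' => eta c * pastLimit (V + W) l' c) l =
        angular a b (fun l' => eta c * pastLimit V l' c) l +
        angular a b (fun l' => eta c * pastLimit W l' c) l := fun a b c => by
      rw [angular_congr (e c) a b hl,
        angular_add (hV.contDiffOn_past_apply c) (hW.contDiffOn_past_apply c) a b hl]
    rw [f, f, f]
    linarith [hV.past_curl a b c l hl, hW.past_curl a b c l hl]

theorem smul (c : ℝ) (hV : IsTestField V) : IsTestField (c • V) where
  zero_off s l hl := by simp [hV.zero_off s l hl]
  smooth := ContDiffOn.const_smul c hV.smooth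
  homogeneous μ hμ s l hl := by
    simp [hV.homogeneous μ hμ s l hl, smul_comm c]
  transversal s l hl := by
    simp [mink_smul_right, hV.transversal s l hl]
  decay w a := by
    obtain ⟨C, ε, hε, H⟩ := hV.decay w a
    refine ⟨(|c| + 1) * C, ε, hε, fun s l hl => ?_⟩
    have e1 : EqOn (fun l' => dotV (c • V) s l' a) (c • fun l' => dotV V s l' a) lightCone := by
      intro l' hl'
      have := deriv_const_smul c (differentiable_time hV.smooth hl' s)
      exact congrFun this a
    rw [angularIter_congr e1 w hl, angularIter_smul c (hV.contDiffOn_dot_apply s a) w hl]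
    have h := H s l hl
    rw [Pi.smul_apply, smul_eq_mul, abs_mul, mul_div_assoc]
    have h0 := abs_nonneg (angularIter w (fun l' => dotV V s l' a) l)
    nlinarith [abs_nonneg c]
  future_limit l hl := by simpa using (hV.future_limit l hl).const_smul c
  past_limit l hl := by
    rw [pastLimit_smul hV c hl]
    exact (hV.past_limit l hl).const_smul c
  past_smooth := (ContDiffOn.const_smul c hV.past_smooth).congr fun _ hl => pastLimit_smul hV c hl
  past_curl a b d l hl := by
    have e : ∀ d, EqOn (fun l' => eta d * pastLimit (c • V) l' d)
        (c • (fun l' => eta d * pastLimit V l' d)) lightCone := by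
      intro d l' hl'
      simp [pastLimit_smul hV c hl', mul_left_comm]
    have f : ∀ a b d, angular a b (fun l' => eta d * pastLimit (c • V) l' d) l =
        c * angular a b (fun l' => eta d * pastLimit V l' d) l := fun a b d => by
      rw [angular_congr (e d) a b hl, angular_smul c (hV.contDiffOn_past_apply d) a b hl]
    rw [f, f, f]
    linear_combination c * hV.past_curl a b d l hl

theorem zero : IsTestField 0 := by
  have hp : pastLimit 0 = 0 := by
    ext1 l
    exact (tendsto_const_nhds (x := (0 : Spacetime))).limUnder_eq
  have hd : dotV 0 = 0 := by
    ext1 s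
    ext1 l
    exact deriv_const s (0 : Spacetime)
  refine ⟨fun _ _ _ => rfl, contDiffOn_const, fun μ _ s l _ => by simp, fun s l _ => by simp [mink],
    fun w a => ⟨1, 1, one_pos, fun s l hl => ?_⟩, fun l _ => tendsto_const_nhds, fun l _ => ?_, ?_,
    fun a b c l _ => ?_⟩
  · have hl0 : 0 < l 0 := hl.2
    rw [hd]
    have : (fun l' : Spacetime => (0 : ℝ → Spacetime → Spacetime) s l' a) = 0 := rfl
    rw [this, angularIter_zero, Pi.zero_apply, abs_zero]
    positivity
  · rw [hp]; exact tendsto_const_nhds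
  · rw [hp]; exact contDiffOn_const
  · rw [hp]
    simp [angular]

end IsTestField

/-- The real vector space of test fields. -/
def TestField : Submodule ℝ (ℝ → Spacetime → Spacetime) where
  carrier := {V | IsTestField V}
  add_mem' := IsTestField.add
  zero_mem' := IsTestField.zero
  smul_mem' c _ h := IsTestField.smul c h

end TestFields
section GaugeField

/-- Smooth functions on `ℝ × lightCone`, homogeneous of degree `-2`, supported in `|s| ≤ l⁰`. -/
structure IsLocalized (F : ℝ → Spacetime → ℝ) : Prop where
  smooth : ContDiffOn ℝ ∞ (fun p : ℝ × Spacetime => F p.1 p.2) (univ ×ˢ lightCone)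
  homogeneous : ∀ μ : ℝ, 0 < μ → ∀ s, ∀ l ∈ lightCone, F (μ * s) (μ • l) = (μ ^ 2)⁻¹ * F s l
  support : ∀ s, ∀ l ∈ lightCone, l 0 < |s| → F s l = 0

namespace IsLocalized
variable {F : ℝ → Spacetime → ℝ}

theorem angular (hF : IsLocalized F) (a b : Fin 4) :
    IsLocalized fun s => AsympField.angular a b (F s) where
  smooth := (contDiffOn_angular₂ hF.smooth a b).mono (prod_mono_right lightCone_subset)
  homogeneous μ hμ s l hl := by
    have hμl := smul_mem_lightCone hμ hl
    have d1 : DifferentiableAt ℝ (fun x => F (μ * s) (retr x)) (μ • l) :=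
      differentiableAt_comp_retr (contDiffOn_slice hF.smooth (μ * s)) hμl
    have d2 := differentiableAt_comp_retr (contDiffOn_slice hF.smooth s) hl
    have e : (fun x => F (μ * s) (retr (μ • x))) =ᶠ[𝓝 l] fun x => (μ ^ 2)⁻¹ * F s (retr x) := by
      filter_upwards [isOpen_offAxis.mem_nhds (lightCone_subset hl)] with x hx
      rw [retr_smul hμ]
      exact hF.homogeneous μ hμ s _ (retr_mem hx)
    have h1 : HasFDerivAt (fun x => F (μ * s) (retr (μ • x)))
        ((fderiv ℝ (fun x => F (μ * s) (retr x)) (μ • l)).comp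
          (μ • ContinuousLinearMap.id ℝ Spacetime)) l :=
      HasFDerivAt.comp (g := fun x => F (μ * s) (retr x)) (f := fun x : Spacetime => μ • x) l
        d1.hasFDerivAt ((hasFDerivAt_id l).const_smul μ)
    have h2 : HasFDerivAt (fun x => (μ ^ 2)⁻¹ * F s (retr x))
        ((μ ^ 2)⁻¹ • fderiv ℝ (fun x => F s (retr x)) l) l := d2.hasFDerivAt.const_mul _
    have h3 := (h1.congr_of_eventuallyEq e.symm).unique h2
    have h4 := congrArg (fun T : Spacetime →L[ℝ] ℝ =>
      T (tangentDir a b l)) h3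
    simp only [ContinuousLinearMap.comp_apply, smul_apply, ContinuousLinearMap.id_apply,
      smul_eq_mul] at h4
    simp only [AsympField.angular]
    rw [← h4]
    congr 1
    simp only [tangentDir, Pi.smul_apply, smul_eq_mul, smul_sub, smul_smul]
    congr 2 <;> ring
  support s l hl hs := by
    have : (fun x => F s (retr x)) =ᶠ[𝓝 l] fun _ => (0 : ℝ) := by
      have hc : ContinuousAt rad l := contDiffOn_rad.continuousOn.continuousAt
        (isOpen_offAxis.mem_nhds (lightCone_subset hl))
      have h1 : ∀ᶠ x in 𝓝 l, rad x < |s| := by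
        have := rad_eq_of_mem hl
        exact hc.eventually_lt_const (this ▸ hs)
      filter_upwards [isOpen_offAxis.mem_nhds (lightCone_subset hl), h1] with x hx hx1
      exact hF.support s _ (retr_mem hx) (by simpa [retr] using hx1)
    simp [AsympField.angular, this.fderiv_eq]

theorem angularIter (hF : IsLocalized F) (w : List (Fin 4 × Fin 4)) :
    IsLocalized fun s => AsympField.angularIter w (F s) := by
  induction w with
  | nil => exact hF
  | cons ab w ih => exact ih.angular ab.1 ab.2

theorem isCompact_section : IsCompact {l : Spacetime | mink l l = 0 ∧ l 0 = 1} := by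
  refine (isCompact_univ_pi (s := fun _ : Fin 4 => Icc (-1 : ℝ) 1)
    fun _ => isCompact_Icc).of_isClosed_subset ?_ ?_
  · refine IsClosed.inter (isClosed_eq ?_ continuous_const) (isClosed_eq (by fun_prop) continuous_const)
    unfold mink
    fun_prop
  · rintro l ⟨h1, h2⟩ i -
    rw [mink_expand] at h1
    change l i ∈ Icc (-1 : ℝ) 1
    rw [mem_Icc, ← abs_le, ← sq_le_one_iff_abs_le_one]
    rw [h2] at h1
    have e0 : l 0 ^ 2 ≤ 1 := by rw [h2]; norm_num
    have e1 : l 1 ^ 2 ≤ 1 := by nlinarith [sq_nonneg (l 2), sq_nonneg (l 3)]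
    have e2 : l 2 ^ 2 ≤ 1 := by nlinarith [sq_nonneg (l 1), sq_nonneg (l 3)]
    have e3 : l 3 ^ 2 ≤ 1 := by nlinarith [sq_nonneg (l 1), sq_nonneg (l 2)]
    fin_cases i <;> assumption

theorem bound (hF : IsLocalized F) : ∃ C : ℝ, ∀ s, ∀ l ∈ lightCone,
    |F s l| < C / (l 0 ^ 2 * (1 + |s| / l 0) ^ (1 + (1 : ℝ))) := by
  obtain ⟨C, hC⟩ := (isCompact_Icc (a := (-1 : ℝ)) (b := 1)).prod isCompact_section
    |>.exists_bound_of_continuousOn (f := fun p : ℝ × Spacetime => F p.1 p.2)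
    (hF.smooth.continuousOn.mono (prod_mono (subset_univ _) fun l hl => ⟨hl.1, by simp [hl.2]⟩))
  have hpos : 0 < 4 * (|C| + 1) := by positivity
  refine ⟨4 * (|C| + 1), fun s l hl => ?_⟩
  have hl0 : 0 < l 0 := hl.2
  have hexp : (1 + |s| / l 0) ^ (1 + (1 : ℝ)) = (1 + |s| / l 0) ^ 2 := by
    rw [show (1 + (1 : ℝ)) = ((2 : ℕ) : ℝ) by norm_num, Real.rpow_natCast]
  rw [hexp]
  by_cases hs : l 0 < |s|
  · rw [hF.support s l hl hs, abs_zero]; positivity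
  · push Not at hs
    have hmem := smul_mem_lightCone (inv_pos.mpr hl0) hl
    have h1 := hF.homogeneous _ hl0 ((l 0)⁻¹ * s) _ hmem
    rw [← mul_assoc, mul_inv_cancel₀ hl0.ne', one_mul, smul_smul, mul_inv_cancel₀ hl0.ne',
      one_smul] at h1
    have h2 := hC ((l 0)⁻¹ * s, (l 0)⁻¹ • l) ⟨by
      rw [mem_Icc, ← abs_le, abs_mul, abs_of_pos (inv_pos.mpr hl0), inv_mul_le_one₀ hl0]
      exact hs, hmem.1, by simp [hl0.ne']⟩
    rw [Real.norm_eq_abs] at h2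
    rw [h1, abs_mul, abs_of_pos (by positivity), lt_div_iff₀ (by positivity)]
    have h3 : |s| / l 0 ≤ 1 := (div_le_one hl0).mpr hs
    have h4 : 0 ≤ |s| / l 0 := by positivity
    have h5 : (1 + |s| / l 0) ^ 2 ≤ 4 := by nlinarith
    set y := |F ((l 0)⁻¹ * s) ((l 0)⁻¹ • l)|
    have h6 : (l 0 ^ 2)⁻¹ * y * (l 0 ^ 2 * (1 + |s| / l 0) ^ 2) = y * (1 + |s| / l 0) ^ 2 := by
      field_simp
    rw [h6]
    have h7 : y < |C| + 1 := by linarith [le_abs_self C]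
    have h8 : 0 ≤ y := abs_nonneg _
    nlinarith [sq_nonneg (1 + |s| / l 0)]

end IsLocalized

/-- A smooth step function, equal to `1` on `(-∞, -1]` and to `0` on `[0, ∞)`. -/
def step (u : ℝ) : ℝ := Real.smoothTransition (-u)

theorem contDiff_step : ContDiff ℝ ∞ step := Real.smoothTransition.contDiff.comp contDiff_neg

theorem step_of_le {u : ℝ} (hu : u ≤ -1) : step u = 1 :=
  Real.smoothTransition.one_of_one_le (by linarith)

theorem step_of_nonneg {u : ℝ} (hu : 0 ≤ u) : step u = 0 :=
  Real.smoothTransition.zero_of_nonpos (by linarith)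

open Classical in
/-- A test field of the form `l α (s, l)` with `α (-∞, l) = c / (t · l)²`, hence `Φ = c`. -/
def constGaugeFun (c : ℝ) (s : ℝ) (l : Spacetime) : Spacetime :=
  if l ∈ lightCone then (c * step (s / l 0) / l 0 ^ 2) • l else 0

theorem constGaugeFun_of_mem (c s : ℝ) {l : Spacetime} (hl : l ∈ lightCone) :
    constGaugeFun c s l = (c * step (s / l 0) / l 0 ^ 2) • l := if_pos hl

theorem constGaugeFun_early (c : ℝ) {s : ℝ} {l : Spacetime} (hl : l ∈ lightCone) (hs : s ≤ -l 0) :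
    constGaugeFun c s l = (c / l 0 ^ 2) • l := by
  rw [constGaugeFun_of_mem c s hl, step_of_le, mul_one]
  rw [div_le_iff₀ hl.2]; linarith

theorem constGaugeFun_late (c : ℝ) {s : ℝ} {l : Spacetime} (hl : l ∈ lightCone) (hs : 0 ≤ s) :
    constGaugeFun c s l = 0 := by
  rw [constGaugeFun_of_mem c s hl, step_of_nonneg (div_nonneg hs hl.2.le)]; simp

theorem constGaugeFun_smooth (c : ℝ) :
    ContDiffOn ℝ ∞ (fun p : ℝ × Spacetime => constGaugeFun c p.1 p.2) (univ ×ˢ lightCone) := by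
  have : ContDiffOn ℝ ∞ (fun p : ℝ × Spacetime => (c * step (p.1 / p.2 0) / p.2 0 ^ 2) • p.2)
      (univ ×ˢ lightCone) := by
    have hn : ∀ p ∈ (univ : Set ℝ) ×ˢ lightCone, p.2 0 ≠ 0 := fun p hp => hp.2.2.ne'
    have h0 : ContDiffOn ℝ ∞ (fun p : ℝ × Spacetime => p.2 0) (univ ×ˢ lightCone) :=
      ContDiff.contDiffOn (by fun_prop)
    have h1 : ContDiffOn ℝ ∞ (fun p : ℝ × Spacetime => p.1 / p.2 0) (univ ×ˢ lightCone) :=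
      contDiffOn_fst.div h0 hn
    refine ContDiffOn.smul (ContDiffOn.div (contDiffOn_const.mul (contDiff_step.comp_contDiffOn h1))
      (h0.pow 2) fun p hp => pow_ne_zero 2 (hn p hp)) contDiffOn_snd
  exact this.congr fun p hp => constGaugeFun_of_mem c p.1 hp.2

theorem constGaugeFun_past (c : ℝ) {l : Spacetime} (hl : l ∈ lightCone) :
    Tendsto (fun s => constGaugeFun c s l) atBot (𝓝 ((c / l 0 ^ 2) • l)) := by
  refine tendsto_const_nhds.congr' ?_
  filter_upwards [eventually_le_atBot (-l 0)] with s hs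
  exact (constGaugeFun_early c hl hs).symm

theorem constGaugeFun_homogeneous (c μ : ℝ) (hμ : 0 < μ) (s : ℝ) (l : Spacetime) (hl : l ∈ lightCone) :
    constGaugeFun c (μ * s) (μ • l) = μ⁻¹ • constGaugeFun c s l := by
  rw [constGaugeFun_of_mem c _ (smul_mem_lightCone hμ hl), constGaugeFun_of_mem c s hl, smul_smul,
    smul_smul]
  have hl0 := hl.2.ne'
  simp only [Pi.smul_apply, smul_eq_mul]
  rw [mul_div_mul_left _ _ hμ.ne']
  congr 1
  field_simp

theorem isLocalized_dot (c : ℝ) (a : Fin 4) :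
    IsLocalized fun s l => dotV (constGaugeFun c) s l a where
  smooth := contDiffOn_pi.mp (contDiffOn_dotV (constGaugeFun_smooth c)) a
  homogeneous μ hμ s l hl := by
    have hμl := smul_mem_lightCone hμ hl
    have d1 := (differentiable_time (constGaugeFun_smooth c) hμl (μ * s)).hasDerivAt
    have d2 := (differentiable_time (constGaugeFun_smooth c) hl s).hasDerivAt
    have h1 := HasDerivAt.scomp s (g₁ := fun u => constGaugeFun c u (μ • l)) (h := fun u => μ * u)
      d1 (by simpa using (hasDerivAt_id s).const_mul μ)
    have e : ((fun u => constGaugeFun c u (μ • l)) ∘ fun u => μ * u) =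
        fun u => μ⁻¹ • constGaugeFun c u l := by
      ext1 u
      exact constGaugeFun_homogeneous c μ hμ u l hl
    rw [e] at h1
    have h3 := congrFun (h1.unique (d2.const_smul μ⁻¹)) a
    simp only [Pi.smul_apply, smul_eq_mul] at h3
    change deriv (fun u => constGaugeFun c u (μ • l)) (μ * s) a =
      (μ ^ 2)⁻¹ * deriv (fun u => constGaugeFun c u l) s a
    field_simp at h3 ⊢
    linarith
  support s l hl hs := by
    have : (fun u => constGaugeFun c u l) =ᶠ[𝓝 s]
        fun _ => if s < 0 then (c / l 0 ^ 2) • l else 0 := by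
      have hl0 := hl.2
      split_ifs with h
      · rw [abs_of_neg h] at hs
        filter_upwards [gt_mem_nhds (show s < -l 0 by linarith)] with u hu
        exact constGaugeFun_early c hl hu.le
      · rw [abs_of_nonneg (not_lt.mp h)] at hs
        filter_upwards [lt_mem_nhds (hl0.trans hs)] with u hu
        exact constGaugeFun_late c hl hu.le
    simp [dotV, this.deriv_eq]

theorem pastLimit_constGaugeFun (c : ℝ) {l : Spacetime} (hl : l ∈ lightCone) :
    pastLimit (constGaugeFun c) l = (c / l 0 ^ 2) • l := (constGaugeFun_past c hl).limUnder_eq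

theorem isTestField_constGaugeFun (c : ℝ) : IsTestField (constGaugeFun c) where
  zero_off s l hl := if_neg hl
  smooth := constGaugeFun_smooth c
  homogeneous μ hμ s l hl := constGaugeFun_homogeneous c μ hμ s l hl
  transversal s l hl := by
    rw [constGaugeFun_of_mem c s hl, mink_smul_right, hl.1, mul_zero]
  decay w a := by
    obtain ⟨C, hC⟩ := ((isLocalized_dot c a).angularIter w).bound
    exact ⟨C, 1, one_pos, hC⟩
  future_limit l hl := by
    refine tendsto_const_nhds.congr' ?_
    filter_upwards [eventually_ge_atTop 0] with s hs
    exact (constGaugeFun_late c hl hs).symm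
  past_limit l hl := by
    rw [pastLimit_constGaugeFun c hl]
    exact constGaugeFun_past c hl
  past_smooth := by
    have h0 : ContDiffOn ℝ ∞ (fun l : Spacetime => l 0 ^ 2) lightCone := ContDiff.contDiffOn (by fun_prop)
    refine ContDiffOn.congr ((contDiffOn_const.div h0 fun l hl => pow_ne_zero 2 hl.2.ne').smul
      contDiffOn_id) fun l hl => pastLimit_constGaugeFun c hl
  past_curl a b d l hl := by
    have hl0 : l 0 ≠ 0 := hl.2.ne'
    have f : ∀ a b d, angular a b (fun l' => eta d * pastLimit (constGaugeFun c) l' d) l =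
        eta d * (c / l 0 ^ 2 * tangentDir a b l d - 2 * c / l 0 ^ 3 * tangentDir a b l 0 * l d) := by
      intro a b d
      have e : EqOn (fun l' => eta d * pastLimit (constGaugeFun c) l' d)
          (fun l' => eta d * (c / l' 0 ^ 2 * l' d)) lightCone := fun l' hl' => by
        simp [pastLimit_constGaugeFun c hl']
      rw [angular_congr e a b hl]
      have h0 : HasFDerivAt (fun x : Spacetime => x 0) (ContinuousLinearMap.proj (R := ℝ) 0) l :=
        hasFDerivAt_apply 0 l
      have h1 : HasDerivAt (fun u : ℝ => c / u ^ 2) (-(2 * c / l 0 ^ 3)) (l 0) := by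
        have := ((hasDerivAt_id (l 0)).pow 2).fun_inv (pow_ne_zero 2 hl0) |>.const_mul c
        refine this.congr_deriv ?_
        simp
        field_simp
      have h2 := ((h1.comp_hasFDerivAt l h0).mul (hasFDerivAt_apply d l)).const_mul (eta d)
      refine (angular_eq_of_hasFDerivAt h2 hl a b).trans ?_
      simp
      ring
    rw [f, f, f]
    simp only [tangentDir, Pi.sub_apply, Pi.smul_apply, smul_eq_mul]
    fin_cases a <;> fin_cases b <;> fin_cases d <;> simp [eta] <;> ring

end GaugeField

section Group

/-- The unit sphere of space. -/
abbrev S2 : Type := Metric.sphere (0 : EuclideanSpace ℝ (Fin 3)) 1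

/-- The null vector `(1, n)`. -/
def ray (n : S2) : Spacetime := ![1, n.1 0, n.1 1, n.1 2]

/-- The spherical angle measure; integrals `∫ f (l) d²l` of functions homogeneous of degree `-2` are
integrals of `f (1, n)` with respect to it. -/
def angle : Measure S2 := (volume : Measure (EuclideanSpace ℝ (Fin 3))).toSphere

instance : IsFiniteMeasure angle := inferInstanceAs (IsFiniteMeasure (Measure.toSphere _))

/-- The function `Φ_V` on the light cone. -/
def Phi (V : ℝ → Spacetime → Spacetime) (l : Spacetime) : ℝ :=
  (4 * Real.pi)⁻¹ * ∫ n, mink l (pastLimit V (ray n)) / mink l (ray n) ∂angle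

/-- The symplectic form. -/
def sympl (V W : ℝ → Spacetime → Spacetime) : ℝ :=
  (4 * Real.pi)⁻¹ * ∫ p : ℝ × S2, (mink (dotV V p.1 (ray p.2)) (W p.1 (ray p.2)) -
    mink (dotV W p.1 (ray p.2)) (V p.1 (ray p.2))) ∂(volume.prod angle)

theorem ray_zero (n : S2) : ray n 0 = 1 := rfl

theorem ray_mem (n : S2) : ray n ∈ lightCone := by
  have h : ‖n.1‖ ^ 2 = 1 := by
    have := n.2
    rw [mem_sphere_zero_iff_norm] at this
    rw [this, one_pow]
  rw [EuclideanSpace.norm_sq_eq, Fin.sum_univ_three] at h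
  simp only [Real.norm_eq_abs, sq_abs] at h
  refine ⟨?_, by simp [ray]⟩
  rw [mink_expand]
  simp only [ray, Matrix.cons_val]
  linarith

theorem continuous_ray : Continuous ray := by
  rw [continuous_pi_iff]
  intro i
  fin_cases i <;> simp [ray] <;> fun_prop

theorem IsTestField.continuous_past_ray {V : ℝ → Spacetime → Spacetime} (hV : IsTestField V) :
    Continuous fun n => pastLimit V (ray n) :=
  hV.past_smooth.continuousOn.comp_continuous continuous_ray ray_mem

theorem dotV_neg (V : ℝ → Spacetime → Spacetime) (s : ℝ) (l : Spacetime) : dotV (-V) s l = -dotV V s l :=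
  deriv.fun_neg

theorem sympl_neg_left_self (V : ℝ → Spacetime → Spacetime) : sympl (-V) V = 0 := by
  have : ∀ p : ℝ × S2, mink (dotV (-V) p.1 (ray p.2)) (V p.1 (ray p.2)) -
    mink (dotV V p.1 (ray p.2)) ((-V) p.1 (ray p.2)) = 0 := fun p => by
    simp only [dotV_neg, mink_expand, Pi.neg_apply]; ring
  simp only [sympl, this, integral_zero, mul_zero]

/-- The test fields equivalent to zero: `V = l α` with `(1/4π) ∫ α (-∞, l) d²l ∈ (2π/e) ℤ`. -/
def gaugeSubgroup (e : ℝ) : AddSubgroup TestField where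
  carrier := {V | ∃ (α : ℝ → Spacetime → ℝ) (α₀ : Spacetime → ℝ),
    (∀ s, ∀ l ∈ lightCone, V.1 s l = α s l • l) ∧
    (∀ l ∈ lightCone, Tendsto (fun s => α s l) atBot (𝓝 (α₀ l))) ∧
    ∃ k : ℤ, (4 * Real.pi)⁻¹ * ∫ n, α₀ (ray n) ∂angle = k * (2 * Real.pi / e)}
  zero_mem' := ⟨0, 0, fun _ _ _ => by simp, fun _ _ => tendsto_const_nhds, 0, by simp⟩
  neg_mem' := by
    rintro V ⟨α, α₀, h1, h2, k, hk⟩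
    refine ⟨-α, -α₀, fun s l hl => ?_, fun l hl => (h2 l hl).neg, -k, ?_⟩
    · simp [h1 s l hl]
    · simp only [Pi.neg_apply, integral_neg, mul_neg, hk]
      push_cast; ring
  add_mem' := by
    have int : ∀ (V : TestField) (α : ℝ → Spacetime → ℝ) (α₀ : Spacetime → ℝ),
        (∀ s, ∀ l ∈ lightCone, V.1 s l = α s l • l) →
        (∀ l ∈ lightCone, Tendsto (fun s => α s l) atBot (𝓝 (α₀ l))) →
        Integrable (fun n => α₀ (ray n)) angle := by
      intro V α α₀ h1 h2
      have hc : Continuous fun n => pastLimit V.1 (ray n) 0 :=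
        (continuous_apply 0).comp (IsTestField.continuous_past_ray V.2)
      have e : (fun n => α₀ (ray n)) = fun n => pastLimit V.1 (ray n) 0 := by
        ext n
        have t1 := ((continuous_apply (0 : Fin 4)).tendsto _).comp
          (IsTestField.past_limit V.2 (ray n) (ray_mem n))
        refine tendsto_nhds_unique (h2 _ (ray_mem n)) (t1.congr fun s => ?_)
        simp [h1 s _ (ray_mem n), ray_zero]
      rw [e]
      exact hc.integrable_of_hasCompactSupport (HasCompactSupport.of_compactSpace _)
    rintro V W ⟨α, α₀, h1, h2, k, hk⟩ ⟨β, β₀, g1, g2, m, hm⟩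
    refine ⟨α + β, α₀ + β₀, fun s l hl => ?_, fun l hl => (h2 l hl).add (g2 l hl), k + m, ?_⟩
    · have : (V + W).1 s l = V.1 s l + W.1 s l := rfl
      rw [this, h1 s l hl, g1 s l hl, ← add_smul]; rfl
    · simp only [Pi.add_apply]
      rw [integral_add (int V α α₀ h1 h2) (int W β β₀ g1 g2), mul_add, hk, hm]
      push_cast; ring

/-- The Abelian group `L` of classes `(V)`. -/
abbrev LGroup (e : ℝ) : Type := TestField ⧸ gaugeSubgroup e

/-- The class `(V)` of a test field. -/
def cls (e : ℝ) (V : TestField) : LGroup e := QuotientAddGroup.mk V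

/-- The test field `l α` with `α (-∞, l) = c / (t · l)²`. -/
def constGauge (c : ℝ) : TestField := ⟨constGaugeFun c, isTestField_constGaugeFun c⟩

theorem angle_univ : angle.real univ = 4 * Real.pi := by
  rw [angle, Measure.toSphere_real_apply_univ, Measure.real, EuclideanSpace.volume_ball_fin_three]
  have : 0 ≤ Real.pi * (4 / 3) := by positivity
  simp
  rw [mul_div_assoc, ENNReal.toReal_ofReal this]
  ring

open scoped Pointwise in
/-- `Φ` of `constGauge c` is the constant `c`: its class is `(0, c mod 2π/e)`. -/
theorem Phi_constGauge (c : ℝ) {l : Spacetime} (hl : l ∈ lightCone) : Phi (constGauge c).1 l = c := by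
  have hl0 := hl.2
  let x : EuclideanSpace ℝ (Fin 3) := !₂[l 1, l 2, l 3]
  have key : ∀ n : S2, mink l (ray n) = 0 → n.1 ∈ Submodule.span ℝ {x} := by
    intro n hn
    have h1 := hl.1
    have h2 := (ray_mem n).1
    rw [mink_expand] at hn h1 h2
    simp only [ray, Matrix.cons_val] at hn h2
    have h3 : (l 0 * n.1 0 - l 1) ^ 2 + (l 0 * n.1 1 - l 2) ^ 2 + (l 0 * n.1 2 - l 3) ^ 2 = 0 := by
      linear_combination l 0 ^ 2 * (-h2) - h1 + 2 * l 0 * hn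
    have s1 := sq_nonneg (l 0 * n.1 0 - l 1)
    have s2 := sq_nonneg (l 0 * n.1 1 - l 2)
    have s3 := sq_nonneg (l 0 * n.1 2 - l 3)
    have e1 : l 0 * n.1 0 - l 1 = 0 := by
      rw [← sq_eq_zero_iff]; linarith
    have e2 : l 0 * n.1 1 - l 2 = 0 := by
      rw [← sq_eq_zero_iff]; linarith
    have e3 : l 0 * n.1 2 - l 3 = 0 := by
      rw [← sq_eq_zero_iff]; linarith
    rw [Submodule.mem_span_singleton]
    refine ⟨(l 0)⁻¹, ?_⟩
    ext i
    fin_cases i <;> simp [x] <;> field_simp <;> linarith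
  have null : ∀ᵐ n ∂angle, mink l (ray n) ≠ 0 := by
    have hm : MeasurableSet {n : S2 | mink l (ray n) = 0} := by
      refine (isClosed_eq ?_ continuous_const).measurableSet
      have := continuous_ray
      unfold mink
      fun_prop
    rw [ae_iff]
    simp only [ne_eq, not_not]
    rw [angle, Measure.toSphere_apply' _ hm]
    have h0 : (volume : Measure (EuclideanSpace ℝ (Fin 3))) (Submodule.span ℝ {x}) = 0 := by
      refine Measure.addHaar_submodule _ _ fun h => ?_
      have h1 := finrank_span_le_card (R := ℝ) ({x} : Set (EuclideanSpace ℝ (Fin 3)))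
      rw [h, finrank_top, finrank_euclideanSpace_fin] at h1
      simp at h1
    have h2 : (Ioo (0 : ℝ) 1 • ((fun n : S2 => n.1) '' {n : S2 | mink l (ray n) = 0})) ⊆
        (Submodule.span ℝ {x} : Set (EuclideanSpace ℝ (Fin 3))) := by
      rintro _ ⟨r, -, _, ⟨n, hn, rfl⟩, rfl⟩
      exact Submodule.smul_mem _ r (key n hn)
    rw [measure_mono_null h2 h0, mul_zero]
  have e : (fun n => mink l (pastLimit (constGauge c).1 (ray n)) / mink l (ray n)) =ᵐ[angle]
      fun _ => c := by
    filter_upwards [null] with n hn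
    change mink l (pastLimit (constGaugeFun c) (ray n)) / mink l (ray n) = c
    rw [pastLimit_constGaugeFun c (ray_mem n), ray_zero, mink_smul_right]
    field_simp
  rw [Phi, integral_congr_ae e, integral_const, angle_univ, smul_eq_mul]
  have := Real.pi_pos
  field_simp

end Group

section OneParticle

/-- The hyperboloid of unit future-pointing timelike vectors. -/
abbrev Hyperboloid : Type := {v : Spacetime // mink v v = 1 ∧ 0 < v 0}

/-- The point of the hyperboloid with given spatial part. -/
def hypPoint (p : Fin 3 → ℝ) : Hyperboloid :=
  ⟨![√(1 + p 0 ^ 2 + p 1 ^ 2 + p 2 ^ 2), p 0, p 1, p 2], by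
    have h : 0 < 1 + p 0 ^ 2 + p 1 ^ 2 + p 2 ^ 2 := by positivity
    refine ⟨?_, ?_⟩
    · rw [mink_expand]
      simp only [Matrix.cons_val]
      nlinarith [Real.mul_self_sqrt h.le]
    · simpa using h⟩

theorem continuous_hypPoint : Continuous hypPoint := by
  refine Continuous.subtype_mk ?_ _
  rw [continuous_pi_iff]
  intro i
  fin_cases i <;> simp <;> fun_prop

/-- The invariant measure `d³v / v⁰` on the hyperboloid. -/
def hypMeasure : Measure Hyperboloid :=
  ((volume : Measure (Fin 3 → ℝ)).withDensity
    fun p => ENNReal.ofReal ((hypPoint p).1 0)⁻¹).map hypPoint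

/-- The space `ℂ⁴` of bispinors. -/
abbrev Spinor : Type := Fin 4 → ℂ

/-- The Dirac matrices `γ^a` (standard representation). -/
def diracGamma : Fin 4 → Matrix (Fin 4) (Fin 4) ℂ :=
  ![!![1, 0, 0, 0; 0, 1, 0, 0; 0, 0, -1, 0; 0, 0, 0, -1],
    !![0, 0, 0, 1; 0, 0, 1, 0; 0, -1, 0, 0; -1, 0, 0, 0],
    !![0, 0, 0, -Complex.I; 0, 0, Complex.I, 0; 0, Complex.I, 0, 0; -Complex.I, 0, 0, 0],
    !![0, 0, 1, 0; 0, 0, 0, -1; -1, 0, 0, 0; 0, 1, 0, 0]]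

/-- `γ · v = γ^a v_a`. -/
def slash (v : Spacetime) : Matrix (Fin 4) (Fin 4) ℂ := ∑ a, ((eta a * v a : ℝ) : ℂ) • diracGamma a

open scoped Matrix in
/-- The sesquilinear form `f̄ γ · v g`, where `f̄ = f† γ⁰` is the Dirac conjugate. -/
def diracForm (v : Hyperboloid) (f g : Spinor) : ℂ :=
  star f ⬝ᵥ ((diracGamma 0 * slash v.1) *ᵥ g)

theorem diracForm_add_self (v : Hyperboloid) (f g : Spinor) :
    diracForm v (f + g) (f + g) + diracForm v (f - g) (f - g) =
      2 * diracForm v f f + 2 * diracForm v g g := by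
  simp only [diracForm, star_add, star_sub, Matrix.mulVec_add, Matrix.mulVec_sub, add_dotProduct,
    sub_dotProduct, dotProduct_add, dotProduct_sub]
  ring

theorem diracForm_smul_self (v : Hyperboloid) (c : ℂ) (f : Spinor) :
    diracForm v (c • f) (c • f) = ((‖c‖ ^ 2 : ℝ) : ℂ) * diracForm v f f := by
  have h : c * star c = ((‖c‖ ^ 2 : ℝ) : ℂ) := by
    rw [← Complex.normSq_eq_norm_sq, Complex.normSq_eq_conj_mul_self, mul_comm]; rfl
  simp only [diracForm, star_smul, Matrix.mulVec_smul, smul_dotProduct, dotProduct_smul,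
    smul_eq_mul, ← mul_assoc, h]

theorem diracForm_expand (v : Hyperboloid) (f g : Spinor) : diracForm v f g =
    star (f 0) * (v.1 0 * g 0 - v.1 3 * g 2 - (v.1 1 - Complex.I * v.1 2) * g 3) +
    star (f 1) * (v.1 0 * g 1 - (v.1 1 + Complex.I * v.1 2) * g 2 + v.1 3 * g 3) +
    star (f 2) * (v.1 0 * g 2 - v.1 3 * g 0 - (v.1 1 - Complex.I * v.1 2) * g 1) +
    star (f 3) * (v.1 0 * g 3 - (v.1 1 + Complex.I * v.1 2) * g 0 + v.1 3 * g 1) := by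
  simp [diracForm, slash, diracGamma, eta, dotProduct, Matrix.mulVec, Fin.sum_univ_four,
    Matrix.mul_apply]
  ring

theorem continuous_diracForm :
    Continuous fun q : Hyperboloid × Spinor => diracForm q.1 q.2 q.2 := by
  have h : ∀ i, Continuous fun q : Hyperboloid × Spinor => q.1.1 i := fun i =>
    (continuous_apply i).comp (continuous_subtype_val.comp continuous_fst)
  have h0 := h 0
  have h1 := h 1
  have h2 := h 2
  have h3 := h 3
  simp only [diracForm_expand]
  fun_prop

/-- Positivity of the form `f̄ γ · v f`. -/
theorem diracForm_self (v : Hyperboloid) (f : Spinor) :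
    ∃ r : ℝ, 0 ≤ r ∧ diracForm v f f = r := by
  obtain ⟨hv, hv0⟩ := v.2
  rw [mink_expand] at hv
  have hvc : (v.1 0 : ℂ) * v.1 0 - v.1 1 * v.1 1 - v.1 2 * v.1 2 - v.1 3 * v.1 3 = 1 := by
    exact_mod_cast hv
  have hv0c : (v.1 0 : ℂ) ≠ 0 := by exact_mod_cast hv0.ne'
  have hsq : ∀ z : ℂ, ((‖z‖ ^ 2 : ℝ) : ℂ) = star z * z := fun z => by
    rw [← Complex.normSq_eq_norm_sq, Complex.normSq_eq_conj_mul_self]; rfl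
  refine ⟨(‖v.1 0 * f 0 - v.1 3 * f 2 - (v.1 1 - Complex.I * v.1 2) * f 3‖ ^ 2 +
    ‖v.1 0 * f 1 - (v.1 1 + Complex.I * v.1 2) * f 2 + v.1 3 * f 3‖ ^ 2 +
    ‖v.1 0 * f 2 - v.1 3 * f 0 - (v.1 1 - Complex.I * v.1 2) * f 1‖ ^ 2 +
    ‖v.1 0 * f 3 - (v.1 1 + Complex.I * v.1 2) * f 0 + v.1 3 * f 1‖ ^ 2 +
    ‖f 0‖ ^ 2 + ‖f 1‖ ^ 2 + ‖f 2‖ ^ 2 + ‖f 3‖ ^ 2) / (2 * v.1 0), by positivity, ?_⟩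
  rw [diracForm_expand, Complex.ofReal_div]
  simp only [Complex.ofReal_add, hsq, Complex.ofReal_mul, Complex.ofReal_ofNat]
  rw [eq_div_iff (by simpa using hv0c)]
  simp only [star_add, star_sub, star_mul', Complex.star_def, Complex.conj_ofReal, Complex.conj_I]
  linear_combination (starRingEnd ℂ (f 0) * f 0 + starRingEnd ℂ (f 1) * f 1 +
    starRingEnd ℂ (f 2) * f 2 + starRingEnd ℂ (f 3) * f 3) * (hvc + v.1 2 ^ 2 * Complex.I_sq)

theorem integrable_diracForm_add {f g : Hyperboloid → Spinor}
    (hfm : AEStronglyMeasurable f hypMeasure) (hgm : AEStronglyMeasurable g hypMeasure)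
    (hf : Integrable (fun v => diracForm v (f v) (f v)) hypMeasure)
    (hg : Integrable (fun v => diracForm v (g v) (g v)) hypMeasure) :
    Integrable (fun v => diracForm v (f v + g v) (f v + g v)) hypMeasure := by
  have h : Integrable (fun v => 2 * diracForm v (f v) (f v) + 2 * diracForm v (g v) (g v))
      hypMeasure := (hf.const_mul (2 : ℂ)).add (hg.const_mul (2 : ℂ))
  have hm : AEStronglyMeasurable (fun v => (v, f v + g v)) hypMeasure :=
    AEStronglyMeasurable.prodMk (f := fun v : Hyperboloid => v) aestronglyMeasurable_id
      (hfm.add hgm)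
  have hm' : AEStronglyMeasurable
      ((fun q : Hyperboloid × Spinor => diracForm q.1 q.2 q.2) ∘ fun v => (v, f v + g v))
      hypMeasure := continuous_diracForm.comp_aestronglyMeasurable hm
  refine Integrable.mono h hm' (ae_of_all _ fun v => ?_)
  rw [← diracForm_add_self]
  obtain ⟨r, hr, e⟩ := diracForm_self v (f v + g v)
  obtain ⟨r', hr', e'⟩ := diracForm_self v (f v - g v)
  rw [e, e', ← Complex.ofReal_add, Complex.norm_real, Complex.norm_real, Real.norm_of_nonneg hr,
    Real.norm_of_nonneg (add_nonneg hr hr')]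
  linarith

/-- The one-particle space: classes of `ℂ⁴`-valued functions on the hyperboloid with finite norm. -/
def OneParticle : Submodule ℂ (Hyperboloid →ₘ[hypMeasure] Spinor) where
  carrier := {f | Integrable (fun v => diracForm v (f v) (f v)) hypMeasure}
  zero_mem' := by
    refine (integrable_zero _ _ _).congr ?_
    filter_upwards [AEEqFun.coeFn_zero (α := Hyperboloid) (β := Spinor) (μ := hypMeasure)] with v hv
    rw [hv]
    simp [diracForm]
  add_mem' := by
    intro f g hf hg
    refine (integrable_diracForm_add f.aestronglyMeasurable g.aestronglyMeasurable hf hg).congr ?_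
    filter_upwards [AEEqFun.coeFn_add f g] with v hv
    rw [hv, Pi.add_apply]
  smul_mem' := by
    intro c f hf
    refine (Integrable.const_mul hf ((‖c‖ ^ 2 : ℝ) : ℂ)).congr ?_
    filter_upwards [AEEqFun.coeFn_smul c f] with v hv
    rw [hv, Pi.smul_apply, diracForm_smul_self]

/-- The scalar product of the one-particle space, antilinear in the first argument. -/
def scalarProd (f g : OneParticle) : ℂ := ∫ v, diracForm v (f.1 v) (g.1 v) ∂hypMeasure

/-- The phase function by which `S_{Φ_V}` multiplies. -/
def phase (e : ℝ) (V : ℝ → Spacetime → Spacetime) (v : Hyperboloid) : ℂ :=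
  Complex.exp (((e / (4 * Real.pi) * ∫ n, Phi V (ray n) / mink v.1 (ray n) ^ 2 ∂angle : ℝ) : ℂ) *
    Complex.I)

theorem norm_phase (e : ℝ) (V : ℝ → Spacetime → Spacetime) (v : Hyperboloid) : ‖phase e V v‖ = 1 :=
  Complex.norm_exp_ofReal_mul_I _

theorem continuous_mink : Continuous fun q : Spacetime × Spacetime => mink q.1 q.2 := by
  unfold mink; fun_prop

theorem measurable_phase (e : ℝ) {V : ℝ → Spacetime → Spacetime} (hV : IsTestField V) :
    Measurable (phase e V) := by
  have h1 : Measurable fun n => Phi V (ray n) := by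
    have : Measurable fun q : S2 × S2 =>
        mink (ray q.1) (pastLimit V (ray q.2)) / mink (ray q.1) (ray q.2) := by
      have c1 := continuous_ray
      have c2 := hV.continuous_past_ray
      have := continuous_mink
      exact (continuous_mink.comp ((c1.comp continuous_fst).prodMk
        (c2.comp continuous_snd))).measurable.div (continuous_mink.comp
        ((c1.comp continuous_fst).prodMk (c1.comp continuous_snd))).measurable
    exact (this.stronglyMeasurable.integral_prod_right').measurable.const_mul _
  have h2 : Measurable fun q : Hyperboloid × S2 => Phi V (ray q.2) / mink q.1.1 (ray q.2) ^ 2 :=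
    (h1.comp measurable_snd).div ((continuous_mink.comp
      ((continuous_subtype_val.comp continuous_fst).prodMk
        (continuous_ray.comp continuous_snd))).measurable.pow_const 2)
  have h3 := (h2.stronglyMeasurable.integral_prod_right' (ν := angle)).measurable
  unfold phase
  fun_prop

/-- The unitary operator `S_{Φ_V}` of the one-particle space. -/
def twist (e : ℝ) (V : TestField) (f : OneParticle) : OneParticle :=
  ⟨AEEqFun.mk (fun v => phase e V.1 v • f.1 v)
    ((measurable_phase e V.2).aestronglyMeasurable.smul f.1.aestronglyMeasurable), by
    have hf : Integrable (fun v => diracForm v (f.1 v) (f.1 v)) hypMeasure := f.2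
    refine hf.congr ?_
    filter_upwards [AEEqFun.coeFn_mk (fun v => phase e V.1 v • f.1 v)
      ((measurable_phase e V.2).aestronglyMeasurable.smul f.1.aestronglyMeasurable)] with v hv
    rw [hv, diracForm_smul_self, norm_phase]
    simp⟩

end OneParticle

/-- The free unital complex *-algebra on symbols `X`: words in the letters `x` (left copy) and `x*`
(right copy) span it. -/
def FreeStarAlg (X : Type) : Type := MonoidAlgebra ℂ (FreeMonoid (X ⊕ X))

namespace FreeStarAlg
variable {X : Type}

instance : Ring (FreeStarAlg X) := inferInstanceAs (Ring (MonoidAlgebra ℂ (FreeMonoid (X ⊕ X))))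
instance : Algebra ℂ (FreeStarAlg X) :=
  inferInstanceAs (Algebra ℂ (MonoidAlgebra ℂ (FreeMonoid (X ⊕ X))))

/-- The generator of the free *-algebra attached to a letter. -/
def letter (y : X ⊕ X) : FreeStarAlg X := MonoidAlgebra.of ℂ (FreeMonoid (X ⊕ X)) (FreeMonoid.of y)

/-- The generator `x`. -/
def gen (x : X) : FreeStarAlg X := letter (Sum.inl x)

theorem ringHom_ext {S : Type*} [Semiring S] {f g : FreeStarAlg X →+* S}
    (h₁ : ∀ c : ℂ, f (algebraMap ℂ _ c) = g (algebraMap ℂ _ c))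
    (h₂ : ∀ y, f (letter y) = g (letter y)) : f = g := by
  have hw : (f : FreeStarAlg X →* S).comp (MonoidAlgebra.of ℂ (FreeMonoid (X ⊕ X))) =
      (g : FreeStarAlg X →* S).comp (MonoidAlgebra.of ℂ (FreeMonoid (X ⊕ X))) :=
    FreeMonoid.hom_eq h₂
  exact MonoidAlgebra.ringHom_ext' (RingHom.ext h₁) hw

/-- The involution as a ring homomorphism into the opposite ring: it conjugates scalars and exchanges
the letters `x` and `x*`. -/
def starHom : FreeStarAlg X →+* (FreeStarAlg X)ᵐᵒᵖ :=
  MonoidAlgebra.liftNCRingHom ((algebraMap ℂ (FreeStarAlg X)ᵐᵒᵖ).comp (starRingEnd ℂ))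
    (FreeMonoid.lift fun y : X ⊕ X => MulOpposite.op (letter y.swap))
    (fun c _ => Algebra.commutes (starRingEnd ℂ c) _)

theorem starHom_algebraMap (c : ℂ) :
    starHom (X := X) (algebraMap ℂ _ c) = MulOpposite.op (algebraMap ℂ _ (starRingEnd ℂ c)) := by
  have : (algebraMap ℂ (FreeStarAlg X) c) =
    (MonoidAlgebra.single 1 c : MonoidAlgebra ℂ (FreeMonoid (X ⊕ X))) := rfl
  rw [this]
  refine (MonoidAlgebra.liftNCRingHom_single _ _ _ _ _).trans ?_
  simp

theorem starHom_letter (y : X ⊕ X) : starHom (letter y) = MulOpposite.op (letter y.swap) := by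
  have : letter y = (MonoidAlgebra.single (FreeMonoid.of y) 1 :
    MonoidAlgebra ℂ (FreeMonoid (X ⊕ X))) := rfl
  rw [this]
  refine (MonoidAlgebra.liftNCRingHom_single _ _ _ _ _).trans ?_
  simp

theorem starHom_starHom (a : FreeStarAlg X) : (starHom (starHom a).unop).unop = a := by
  have h : ((RingEquiv.opOp (FreeStarAlg X)).symm.toRingHom.comp
      ((RingHom.op starHom).comp starHom)) = RingHom.id (FreeStarAlg X) := by
    apply ringHom_ext
    · intro c
      simp [starHom_algebraMap]
    · intro y
      simp [starHom_letter]
  exact congrArg (fun f : FreeStarAlg X →+* FreeStarAlg X => f a) h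

instance : StarRing (FreeStarAlg X) where
  star a := (starHom a).unop
  star_involutive := starHom_starHom
  star_mul a b := by simp
  star_add a b := by simp

theorem star_def (a : FreeStarAlg X) : star a = (starHom a).unop := rfl

instance : StarModule ℂ (FreeStarAlg X) where
  star_smul c a := by
    rw [Algebra.smul_def, star_mul, star_def (algebraMap ℂ _ c), starHom_algebraMap,
      Algebra.smul_def]
    exact (Algebra.commutes _ _).symm

theorem induction {P : FreeStarAlg X → Prop} (a : FreeStarAlg X)
    (scalar : ∀ c : ℂ, P (algebraMap ℂ _ c)) (lett : ∀ y, P (letter y))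
    (add : ∀ a b, P a → P b → P (a + b)) (mul : ∀ a b, P a → P b → P (a * b)) : P a := by
  let S : Subsemiring (FreeStarAlg X) :=
    { carrier := {a | P a}
      mul_mem' := fun {a b} ha hb => mul a b ha hb
      one_mem' := by simpa using scalar 1
      add_mem' := fun {a b} ha hb => add a b ha hb
      zero_mem' := by simpa using scalar 0 }
  have key : ∀ w : FreeMonoid (X ⊕ X), MonoidAlgebra.of ℂ (FreeMonoid (X ⊕ X)) w ∈ S := by
    intro w
    induction w using FreeMonoid.recOn with
    | one => exact S.one_mem
    | of_mul x xs ih => rw [map_mul]; exact S.mul_mem (lett x) ih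
  have : ∀ b : MonoidAlgebra ℂ (FreeMonoid (X ⊕ X)), b ∈ S := by
    intro b
    refine MonoidAlgebra.induction_on (motive := fun b => b ∈ S) b key (fun f g hf hg => S.add_mem hf hg) ?_
    intro r (f : FreeStarAlg X) hf
    have h2 : (r • f : FreeStarAlg X) ∈ S := by
      rw [Algebra.smul_def]
      exact S.mul_mem (scalar r) hf
    exact h2
  exact this a

end FreeStarAlg

section MaximalNorm

/-- A C*-norm on a unital complex *-algebra: a submultiplicative norm with `p (a* a) = p (a) ^ 2`. -/
structure CStarNorm (A : Type*) [Ring A] [StarRing A] [Algebra ℂ A] extends Seminorm ℂ A where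
  eq_zero_of_map_eq_zero' : ∀ a, toFun a = 0 → a = 0
  mul_le' : ∀ a b, toFun (a * b) ≤ toFun a * toFun b
  star_mul_self' : ∀ a, toFun (star a * a) = toFun a ^ 2

variable {A : Type*} [Ring A] [StarRing A] [Algebra ℂ A]

/-- The supremum of all C*-norms. -/
def maxCStarNorm (a : A) : ℝ := ⨆ p : CStarNorm A, p.toSeminorm a

/-- All C*-norms are jointly bounded at every element. -/
def JointlyBounded (A : Type*) [Ring A] [StarRing A] [Algebra ℂ A] : Prop :=
  ∀ a : A, BddAbove (Set.range fun p : CStarNorm A => p.toSeminorm a)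

namespace CStarNorm
variable (p : CStarNorm A)

theorem mul_le (a b : A) : p.toSeminorm (a * b) ≤ p.toSeminorm a * p.toSeminorm b := p.mul_le' a b
theorem star_mul_self (a : A) : p.toSeminorm (star a * a) = p.toSeminorm a ^ 2 := p.star_mul_self' a

theorem le_star (a : A) : p.toSeminorm a ≤ p.toSeminorm (star a) := by
  have h := p.star_mul_self a
  have h2 := p.mul_le (star a) a
  rcases (apply_nonneg p.toSeminorm a).eq_or_lt with h0 | h0
  · rw [← h0]; exact apply_nonneg _ _
  · nlinarith

theorem map_star (a : A) : p.toSeminorm (star a) = p.toSeminorm a :=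
  le_antisymm (by simpa using p.le_star (star a)) (p.le_star a)

theorem map_one_le : p.toSeminorm 1 ≤ 1 := by
  have h := p.star_mul_self 1
  simp only [star_one, mul_one] at h
  nlinarith [apply_nonneg p.toSeminorm (1 : A)]

end CStarNorm

theorem maxCStarNorm_nonneg (a : A) : 0 ≤ maxCStarNorm a :=
  Real.iSup_nonneg fun p => apply_nonneg p.toSeminorm a

theorem maxCStarNorm_star (a : A) : maxCStarNorm (star a) = maxCStarNorm a := by
  simp [maxCStarNorm, CStarNorm.map_star]

theorem JointlyBounded.le (hA : JointlyBounded A) (p : CStarNorm A) (a : A) : p.toSeminorm a ≤ maxCStarNorm a := le_ciSup (hA a) p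

theorem JointlyBounded.add_le (hA : JointlyBounded A) (a b : A) : maxCStarNorm (a + b) ≤ maxCStarNorm a + maxCStarNorm b :=
  Real.iSup_le (fun p => (map_add_le_add p.toSeminorm a b).trans (add_le_add (hA.le p a) (hA.le p b)))
    (add_nonneg (maxCStarNorm_nonneg a) (maxCStarNorm_nonneg b))

theorem JointlyBounded.mul_le (hA : JointlyBounded A) (a b : A) : maxCStarNorm (a * b) ≤ maxCStarNorm a * maxCStarNorm b :=
  Real.iSup_le (fun p => (p.mul_le a b).trans (mul_le_mul (hA.le p a) (hA.le p b)
    (apply_nonneg _ _) (maxCStarNorm_nonneg a)))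
    (mul_nonneg (maxCStarNorm_nonneg a) (maxCStarNorm_nonneg b))

theorem JointlyBounded.sq_le (hA : JointlyBounded A) (a : A) : maxCStarNorm a * maxCStarNorm a ≤ maxCStarNorm (star a * a) := by
  have h0 := maxCStarNorm_nonneg (star a * a)
  have : maxCStarNorm a ≤ √(maxCStarNorm (star a * a)) := by
    refine Real.iSup_le (fun p => Real.le_sqrt_of_sq_le ?_) (Real.sqrt_nonneg _)
    rw [← p.star_mul_self]; exact hA.le p _
  calc _ ≤ √(maxCStarNorm (star a * a)) * √(maxCStarNorm (star a * a)) :=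
        mul_self_le_mul_self (maxCStarNorm_nonneg a) this
    _ = _ := Real.mul_self_sqrt h0

theorem JointlyBounded.smul_le (hA : JointlyBounded A) (c : ℂ) (a : A) : maxCStarNorm (c • a) ≤ ‖c‖ * maxCStarNorm a :=
  Real.iSup_le (fun p => by
    rw [map_smul_eq_mul]; exact mul_le_mul_of_nonneg_left (hA.le p a) (norm_nonneg c))
    (mul_nonneg (norm_nonneg c) (maxCStarNorm_nonneg a))

/-- A copy of the *-algebra `A`, normed by the supremum of all C*-norms. -/
def WithMaxNorm (A : Type*) : Type _ := A

namespace WithMaxNorm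

instance : Ring (WithMaxNorm A) := inferInstanceAs (Ring A)
instance : StarRing (WithMaxNorm A) := inferInstanceAs (StarRing A)
instance : Algebra ℂ (WithMaxNorm A) := inferInstanceAs (Algebra ℂ A)
instance [StarModule ℂ A] : StarModule ℂ (WithMaxNorm A) := inferInstanceAs (StarModule ℂ A)

/-- The supremum of all C*-norms as a ring seminorm. -/
def ringSeminorm (hA : JointlyBounded A) : RingSeminorm (WithMaxNorm A) where
  toFun := maxCStarNorm (A := A)
  map_zero' := by
    change (⨆ p : CStarNorm A, p.toSeminorm (0 : A)) = 0
    simp only [map_zero, Real.iSup_const_zero]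
  add_le' := hA.add_le
  neg' a := by
    change (⨆ p : CStarNorm A, p.toSeminorm (-(show A from a))) = ⨆ p : CStarNorm A, p.toSeminorm a
    exact iSup_congr fun p => map_neg_eq_map p.toSeminorm (show A from a)
  mul_le' := hA.mul_le

variable [hA : Fact (JointlyBounded A)]

instance : SeminormedRing (WithMaxNorm A) := (ringSeminorm hA.out).toSeminormedRing

theorem norm_def (a : WithMaxNorm A) : ‖a‖ = maxCStarNorm (A := A) a := rfl

instance : NormedAlgebra ℂ (WithMaxNorm A) where
  norm_smul_le := hA.out.smul_le

instance : NormedStarGroup (WithMaxNorm A) where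
  norm_star_le a := (maxCStarNorm_star (A := A) a).le

end WithMaxNorm

/-- The completion of a *-algebra in the supremum of all its C*-norms. -/
abbrev CStarCompletion (A : Type*) [Ring A] [StarRing A] [Algebra ℂ A]
    [Fact (JointlyBounded A)] : Type _ :=
  UniformSpace.Completion (WithMaxNorm A)

namespace CStarCompletion
open UniformSpace UniformSpace.Completion
variable [hA : Fact (JointlyBounded A)]

instance : Star (CStarCompletion A) := ⟨Completion.map star⟩

theorem uniformContinuous_star' : UniformContinuous (star : WithMaxNorm A → WithMaxNorm A) :=
  (starNormedAddGroupHom : NormedAddGroupHom (WithMaxNorm A) (WithMaxNorm A)).uniformContinuous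

theorem star_coe (a : WithMaxNorm A) :
    star (a : CStarCompletion A) = ((star a : WithMaxNorm A) : CStarCompletion A) :=
  Completion.map_coe uniformContinuous_star' a

theorem continuous_star' : Continuous (star : CStarCompletion A → CStarCompletion A) :=
  Completion.continuous_map

instance : StarRing (CStarCompletion A) where
  star_involutive a := by
    induction a using Completion.induction_on with
    | hp => exact isClosed_eq (continuous_star'.comp continuous_star') continuous_id
    | ih a => simp only [star_coe, star_star]
  star_mul a b := by
    induction a, b using Completion.induction_on₂ with
    | hp => exact isClosed_eq (continuous_star'.comp (continuous_fst.mul continuous_snd))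
              ((continuous_star'.comp continuous_snd).mul (continuous_star'.comp continuous_fst))
    | ih a b => rw [← coe_mul, star_coe, star_mul, coe_mul, star_coe, star_coe]
  star_add a b := by
    induction a, b using Completion.induction_on₂ with
    | hp => exact isClosed_eq (continuous_star'.comp (continuous_fst.add continuous_snd))
              ((continuous_star'.comp continuous_fst).add (continuous_star'.comp continuous_snd))
    | ih a b => rw [← coe_add, star_coe, star_add, coe_add, star_coe, star_coe]

instance : NormedAlgebra ℂ (CStarCompletion A) where
  norm_smul_le := norm_smul_le

instance [StarModule ℂ A] : CStarAlgebra (CStarCompletion A) where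
  norm_mul_self_le a := by
    induction a using Completion.induction_on with
    | hp => exact isClosed_le (continuous_norm.mul continuous_norm)
              (continuous_norm.comp (continuous_star'.mul continuous_id))
    | ih a =>
      rw [star_coe, ← coe_mul, norm_coe, norm_coe]
      exact hA.out.sq_le a
  star_smul c a := by
    induction a using Completion.induction_on with
    | hp => exact isClosed_eq (continuous_star'.comp (continuous_const_smul c))
              (continuous_star'.const_smul (star c))
    | ih a => rw [← coe_smul, star_coe, star_smul, coe_smul, star_coe]

/-- The canonical *-homomorphism of a *-algebra into its completion. -/
def of [StarModule ℂ A] : A →⋆ₐ[ℂ] CStarCompletion A where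
  toFun a := ((show WithMaxNorm A from a : WithMaxNorm A) : CStarCompletion A)
  map_one' := rfl
  map_mul' a b := coe_mul (α := WithMaxNorm A) a b
  map_zero' := rfl
  map_add' a b := coe_add (α := WithMaxNorm A) a b
  commutes' _ := rfl
  map_star' a := (star_coe (A := A) a).symm

theorem denseRange_of [StarModule ℂ A] : DenseRange (of : A → CStarCompletion A) :=
  Completion.denseRange_coe (α := WithMaxNorm A)

end CStarCompletion

end MaximalNorm

section Algebra

/-- Generating symbols of the field algebra: Weyl elements and fermionic elements. -/
inductive Symb (e : ℝ) : Type
  | weyl : LGroup e → Symb e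
  | ferm : OneParticle → Symb e

/-- The symbol `W (x)` in the free *-algebra. -/
def weylGen (e : ℝ) (x : LGroup e) : FreeStarAlg (Symb e) := FreeStarAlg.gen (Symb.weyl x)

/-- The symbol `B (g)` in the free *-algebra. -/
def fermGen (e : ℝ) (g : OneParticle) : FreeStarAlg (Symb e) := FreeStarAlg.gen (Symb.ferm g)

/-- The defining relations of the *-algebra `𝓑`, closed under the involution. -/
inductive Rel (e : ℝ) : FreeStarAlg (Symb e) → FreeStarAlg (Symb e) → Prop
  | weyl_star (x : LGroup e) : Rel e (star (weylGen e x)) (weylGen e (-x))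
  | weyl_zero : Rel e (weylGen e 0) 1
  | weyl_mul (V W : TestField) : Rel e (weylGen e (cls e V) * weylGen e (cls e W))
      (Complex.exp (-(Complex.I / 2) * (sympl V.1 W.1 : ℝ)) • weylGen e (cls e V + cls e W))
  | ferm_add (f g : OneParticle) : Rel e (fermGen e (f + g)) (fermGen e f + fermGen e g)
  | ferm_smul (c : ℂ) (g : OneParticle) : Rel e (fermGen e (c • g)) (star c • fermGen e g)
  | car_zero (f g : OneParticle) : Rel e (fermGen e f * fermGen e g + fermGen e g * fermGen e f) 0
  | car_star (f g : OneParticle) :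
      Rel e (fermGen e f * star (fermGen e g) + star (fermGen e g) * fermGen e f)
        (scalarProd f g • (1 : FreeStarAlg (Symb e)))
  | weyl_ferm (V : TestField) (g : OneParticle) : Rel e (weylGen e (cls e V) * fermGen e g)
      (fermGen e (twist e V g) * weylGen e (cls e V))
  | star {a b : FreeStarAlg (Symb e)} : Rel e a b → Rel e (star a) (star b)

/-- The *-algebra `𝓑` generated by the elements `W (x)`, `B (g)` and the identity. -/
def PreField (e : ℝ) : Type := RingQuot (Rel e)

namespace PreField
variable {e : ℝ}

instance : Ring (PreField e) := inferInstanceAs (Ring (RingQuot (Rel e)))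
instance : Algebra ℂ (PreField e) := inferInstanceAs (Algebra ℂ (RingQuot (Rel e)))
instance : StarRing (PreField e) := RingQuot.starRing (Rel e) fun _ _ h => Rel.star h

/-- The quotient map. -/
def mk : FreeStarAlg (Symb e) →ₐ[ℂ] PreField e := RingQuot.mkAlgHom ℂ (Rel e)

theorem mk_surjective : Function.Surjective (mk (e := e)) := RingQuot.mkAlgHom_surjective ℂ (Rel e)

theorem mk_rel {a b : FreeStarAlg (Symb e)} (h : Rel e a b) : mk a = mk b :=
  RingQuot.mkAlgHom_rel ℂ h

theorem mk_star (a : FreeStarAlg (Symb e)) : mk (star a) = star (mk a) := by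
  have h : ∀ b, mk b = RingQuot.mkRingHom (Rel e) b := fun b =>
    congrArg (fun f : FreeStarAlg (Symb e) →+* RingQuot (Rel e) => f b)
      (RingQuot.mkAlgHom_coe ℂ (Rel e))
  rw [h, h, RingQuot.mkRingHom_def]
  rfl

instance : StarModule ℂ (PreField e) where
  star_smul c a := by
    obtain ⟨a, rfl⟩ := mk_surjective a
    rw [← map_smul, ← mk_star, star_smul, map_smul, mk_star]

/-- The element `W (x)` of `𝓑`. -/
def weyl (x : LGroup e) : PreField e := mk (weylGen e x)

/-- The element `B (g)` of `𝓑`. -/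
def ferm (g : OneParticle) : PreField e := mk (fermGen e g)

theorem star_weyl_mul_self (x : LGroup e) : star (weyl x) * weyl x = 1 := by
  obtain ⟨V, rfl⟩ := QuotientAddGroup.mk_surjective x
  have h1 : star (weyl (cls e V)) = weyl (cls e (-V)) := by
    rw [weyl, ← mk_star, mk_rel (Rel.weyl_star (cls e V))]; rfl
  have h2 := mk_rel (Rel.weyl_mul (e := e) (-V) V)
  have h3 : cls e (-V) + cls e V = 0 := neg_add_cancel (cls e V)
  rw [map_mul, map_smul, h3, mk_rel Rel.weyl_zero, map_one] at h2
  have h4 : sympl (-V : TestField).1 V.1 = 0 := sympl_neg_left_self V.1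
  rw [h4] at h2
  change star (weyl (cls e V)) * weyl (cls e V) = 1
  rw [h1, weyl, weyl, h2]
  simp

theorem ferm_sq (g : OneParticle) : (ferm g : PreField e) * ferm g = 0 := by
  have h := mk_rel (Rel.car_zero (e := e) g g)
  rw [map_add, map_mul, map_zero] at h
  have h2 : (2 : ℂ) • ((ferm g : PreField e) * ferm g) = 0 := by rw [two_smul]; exact h
  exact (smul_eq_zero.mp h2).resolve_left two_ne_zero

theorem ferm_star (g : OneParticle) : (ferm g : PreField e) * star (ferm g) + star (ferm g) * ferm g =
    scalarProd g g • (1 : PreField e) := by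
  have h := mk_rel (Rel.car_star (e := e) g g)
  rwa [map_add, map_mul, map_mul, map_smul, map_one, mk_star] at h

theorem weyl_le (p : CStarNorm (PreField e)) (x : LGroup e) : p.toSeminorm (weyl x) ≤ 1 := by
  have h := p.star_mul_self (weyl x)
  rw [star_weyl_mul_self] at h
  have := p.map_one_le
  have h0 := apply_nonneg p.toSeminorm (weyl x)
  nlinarith

theorem ferm_le (p : CStarNorm (PreField e)) (g : OneParticle) :
    p.toSeminorm (ferm g) ≤ ‖scalarProd g g‖ + 1 := by
  set b : PreField e := ferm g
  have h1 : star (star b * b) * (star b * b) = scalarProd g g • (star b * b) := by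
    have h2 : star b * b = scalarProd g g • (1 : PreField e) - b * star b := by
      rw [← ferm_star g]; abel
    have h3 : star (star b * b) = star b * b := by simp
    calc star (star b * b) * (star b * b) = (star b * b) * (star b * b) := by rw [h3]
      _ = star b * (scalarProd g g • (1 : PreField e) - star b * b) * b := by
          rw [← ferm_star g]; noncomm_ring
      _ = scalarProd g g • (star b * b) - star b * star b * (b * b) := by
          simp [mul_sub, sub_mul, mul_assoc]
      _ = _ := by rw [ferm_sq, mul_zero, sub_zero]
  have h2 := p.star_mul_self (star b * b)
  rw [h1, map_smul_eq_mul, p.star_mul_self] at h2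
  have h0 := apply_nonneg p.toSeminorm b
  set y := p.toSeminorm b
  have hn := norm_nonneg (scalarProd g g)
  by_contra hlt
  push Not at hlt
  have h3 : 0 < y ^ 2 := by nlinarith
  have h4 : ‖scalarProd g g‖ = y ^ 2 := by
    have : ‖scalarProd g g‖ * y ^ 2 = y ^ 2 * y ^ 2 := by linarith [sq (y ^ 2)]
    exact mul_right_cancel₀ h3.ne' this
  nlinarith

theorem jointlyBounded : JointlyBounded (PreField e) := by
  intro a
  obtain ⟨a, rfl⟩ := mk_surjective a
  suffices h : ∃ M, ∀ p : CStarNorm (PreField e), p.toSeminorm (mk a) ≤ M by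
    obtain ⟨M, hM⟩ := h
    exact ⟨M, by rintro _ ⟨p, rfl⟩; exact hM p⟩
  induction a using FreeStarAlg.induction with
  | scalar c =>
    refine ⟨‖c‖, fun p => ?_⟩
    rw [AlgHom.commutes, Algebra.algebraMap_eq_smul_one, map_smul_eq_mul]
    exact mul_le_of_le_one_right (norm_nonneg c) p.map_one_le
  | lett y =>
    have hg : ∀ x : Symb e, ∃ M, ∀ p : CStarNorm (PreField e),
        p.toSeminorm (mk (FreeStarAlg.gen x)) ≤ M := by
      rintro (x | g)
      · exact ⟨1, fun p => weyl_le p x⟩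
      · exact ⟨_, fun p => ferm_le p g⟩
    rcases y with x | x
    · exact hg x
    · obtain ⟨M, hM⟩ := hg x
      refine ⟨M, fun p => ?_⟩
      have : (FreeStarAlg.letter (Sum.inr x) : FreeStarAlg (Symb e)) = star (FreeStarAlg.gen x) := by
        rw [FreeStarAlg.star_def, FreeStarAlg.gen, FreeStarAlg.starHom_letter]; rfl
      rw [this, mk_star, p.map_star]
      exact hM p
  | add a b ha hb =>
    obtain ⟨M, hM⟩ := ha
    obtain ⟨N, hN⟩ := hb
    refine ⟨M + N, fun p => ?_⟩
    rw [map_add]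
    exact (map_add_le_add p.toSeminorm _ _).trans (add_le_add (hM p) (hN p))
  | mul a b ha hb =>
    obtain ⟨M, hM⟩ := ha
    obtain ⟨N, hN⟩ := hb
    refine ⟨M * N, fun p => ?_⟩
    rw [map_mul]
    exact (p.mul_le _ _).trans (mul_le_mul (hM p) (hN p) (apply_nonneg _ _)
      ((apply_nonneg _ _).trans (hM p)))

instance : Fact (JointlyBounded (PreField e)) := ⟨jointlyBounded⟩

end PreField

/-- The asymptotic field algebra `𝓕`: the completion of `𝓑` in the supremum of all its C*-norms. -/
abbrev FieldAlgebra (e : ℝ) : Type := CStarCompletion (PreField e)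

/-- The Weyl element `W (x)` of the field algebra. -/
def Weyl (e : ℝ) (x : LGroup e) : FieldAlgebra e := CStarCompletion.of (PreField.weyl x)

/-- The element `B (g)` of the field algebra. -/
def B (e : ℝ) (g : OneParticle) : FieldAlgebra e := CStarCompletion.of (PreField.ferm g)

/-- The element `W ((0, c mod 2π/e))`. -/
def gaugeWeyl (e c : ℝ) : FieldAlgebra e := Weyl e (cls e (constGauge c))

end Algebra

section Representations

variable {e : ℝ} {H : Type*} [NormedAddCommGroup H] [InnerProductSpace ℂ H] [CompleteSpace H]

/-- Charge-representation: the group `c ↦ π (W ((0, c mod 2π/e)))` is strongly continuous. -/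
def IsChargeRep (π : FieldAlgebra e →⋆ₐ[ℂ] (H →L[ℂ] H)) : Prop :=
  ∀ ψ : H, Continuous fun c : ℝ => π (gaugeWeyl e c) ψ

/-- The charge operator `Q`, defined by `π (W ((0, c mod 2π/e))) = exp (i c Q)`: the operator
`-i d/dc` at `c = 0`, on the domain of all vectors for which the derivative exists. -/
def chargeOp (π : FieldAlgebra e →⋆ₐ[ℂ] (H →L[ℂ] H)) : H →ₗ.[ℂ] H where
  domain :=
    { carrier := {ψ | DifferentiableAt ℝ (fun c : ℝ => π (gaugeWeyl e c) ψ) 0}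
      zero_mem' := by simp
      add_mem' := fun {ψ φ} hψ hφ => by
        simp only [mem_ofPred_eq, map_add] at *
        exact hψ.add hφ
      smul_mem' := fun z ψ hψ => by
        simp only [mem_ofPred_eq, map_smul] at *
        exact hψ.const_smul z }
  toFun :=
    { toFun := fun ψ => -Complex.I • deriv (fun c : ℝ => π (gaugeWeyl e c) (ψ : H)) 0
      map_add' := fun ψ φ => by
        have h : deriv (fun c : ℝ => π (gaugeWeyl e c) (ψ : H) + π (gaugeWeyl e c) (φ : H)) 0 = _ :=
          deriv_fun_add ψ.2 φ.2
        simp only [Submodule.coe_add, map_add, h, smul_add]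
      map_smul' := fun z ψ => by
        have h : deriv (fun c : ℝ => z • π (gaugeWeyl e c) (ψ : H)) 0 = _ :=
          deriv_fun_const_smul z ψ.2
        simp only [Submodule.coe_smul, map_smul, h, RingHom.id_apply, smul_comm z] }

/-- The eigenspace of the charge operator to the value `q`. -/
def chargeEigenspace (π : FieldAlgebra e →⋆ₐ[ℂ] (H →L[ℂ] H)) (q : ℝ) : Submodule ℂ H where
  carrier := {ψ | ∃ h : ψ ∈ (chargeOp π).domain, chargeOp π ⟨ψ, h⟩ = (q : ℂ) • ψ}
  zero_mem' := ⟨Submodule.zero_mem _, by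
    rw [smul_zero]; exact (chargeOp π).map_zero⟩
  add_mem' := by
    rintro ψ φ ⟨h, e₁⟩ ⟨h', e₂⟩
    refine ⟨Submodule.add_mem _ h h', ?_⟩
    rw [smul_add, ← e₁, ← e₂, ← LinearPMap.map_add]; rfl
  smul_mem' := by
    rintro z ψ ⟨h, e₁⟩
    refine ⟨Submodule.smul_mem _ z h, ?_⟩
    rw [smul_comm, ← e₁, ← LinearPMap.map_smul]; rfl

/-- A subspace `S` is cyclic: the closed linear span of `π (𝓕) S` is the whole space. -/
def IsCyclicSubspace (π : FieldAlgebra e →⋆ₐ[ℂ] (H →L[ℂ] H)) (S : Submodule ℂ H) : Prop :=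
  (Submodule.span ℂ {φ | ∃ (a : FieldAlgebra e) (ψ : H), ψ ∈ S ∧ φ = π a ψ}).topologicalClosure = ⊤

/-- All charges `ke` occur, and each charge eigenspace is cyclic. -/
def IsFullChargeType (π : FieldAlgebra e →⋆ₐ[ℂ] (H →L[ℂ] H)) : Prop :=
  ∀ k : ℤ, chargeEigenspace π (k * e) ≠ ⊥ ∧ IsCyclicSubspace π (chargeEigenspace π (k * e))

/-- The vectors annihilated by all `π (B (g))`. -/
def annihilatedByB (π : FieldAlgebra e →⋆ₐ[ℂ] (H →L[ℂ] H)) : Submodule ℂ H :=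
  ⨅ g : OneParticle, LinearMap.ker (π (B e g)).toLinearMap

/-- The vectors annihilated by all `π (B (g)*)`. -/
def annihilatedByBStar (π : FieldAlgebra e →⋆ₐ[ℂ] (H →L[ℂ] H)) : Submodule ℂ H :=
  ⨅ g : OneParticle, LinearMap.ker (π (star (B e g))).toLinearMap

/-- A closed subspace invariant under a representation. -/
structure InvariantSubspace (π : FieldAlgebra e →⋆ₐ[ℂ] (H →L[ℂ] H)) where
  space : Submodule ℂ H
  isClosed : IsClosed (space : Set H)
  invariant : ∀ (a : FieldAlgebra e) (ψ : H), ψ ∈ space → π a ψ ∈ space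

namespace InvariantSubspace
variable {π : FieldAlgebra e →⋆ₐ[ℂ] (H →L[ℂ] H)}

instance (M : InvariantSubspace π) : CompleteSpace M.space := M.isClosed.completeSpace_coe

/-- The restriction of a representation to a closed invariant subspace. -/
def restrict (M : InvariantSubspace π) : FieldAlgebra e →⋆ₐ[ℂ] (M.space →L[ℂ] M.space) where
  toFun a := ((π a).comp M.space.subtypeL).codRestrict M.space fun ψ => M.invariant a ψ ψ.2
  map_one' := by ext; simp
  map_mul' a b := by
    ext ψ
    change π (a * b) ψ = π a (π b ψ)
    rw [map_mul]; rfl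
  map_zero' := by ext; simp
  map_add' a b := by
    ext ψ
    change π (a + b) ψ = π a ψ + π b ψ
    rw [map_add]; rfl
  commutes' z := by
    ext ψ
    simp [Algebra.algebraMap_eq_smul_one]
  map_star' a := by
    rw [ContinuousLinearMap.star_eq_adjoint, ContinuousLinearMap.eq_adjoint_iff]
    intro ψ φ
    change inner ℂ (π (star a) (ψ : H)) (φ : H) = inner ℂ (ψ : H) (π a (φ : H))
    rw [map_star, ContinuousLinearMap.star_eq_adjoint, ContinuousLinearMap.adjoint_inner_left]

theorem restrict_apply (M : InvariantSubspace π) (a : FieldAlgebra e) (ψ : M.space) :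
    (M.restrict a ψ : H) = π a ψ := rfl

end InvariantSubspace

end Representations

end
end AsympField

/-! The constant gauge elements W((0, c mod 2π/e)) act in a charge-representation as a strongly
continuous one-parameter unitary group. It has no cocycle, because test fields proportional to l
have vanishing symplectic product, and it is trivial at c = 2π/e, because that test field is
equivalent to zero. The group therefore factors through a circle, and the vector-valued Fourier
coefficients of an orbit are charge eigenvectors with charges in eℤ. They cannot all vanish on the
orbit of a nonzero vector, so a nonzero representation space carries at least one charge ke
(`exists_chargeSector_ne_bot`).

For Φ = c the one-particle operator S_Φ is multiplication by the scalar exp(iec), since the integral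
of (v·l)⁻² over null directions is 4π for every unit timelike v (`integral_inv_mink_sq`). Hence each
B(g), being antilinear in g, lowers the charge by e, and each B(g)* raises it by e. Suppose that no
nonzero vector is annihilated by all B(g), and none by all B(g)*. Then a neighbour of an occupied
charge is occupied, so all charges ke occur (`chargeSector_ne_bot`). The same conclusion applies to
every closed invariant subspace. If the charge-ke eigenspace failed to be cyclic, the orthogonal
complement of what it generates would itself contain a vector of charge ke, which is absurd
(`isFullChargeType`).

The decomposition follows: H₂ is generated by the vectors annihilated by all B(g), H₃ by the vectors
of H₂⊥ annihilated by all B(g)*, and H₁ is the orthogonal complement of both. By construction H₁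
contains no nonzero vector of either kind. -/

namespace AsympField
noncomputable section
open MeasureTheory Filter Topology Set
open scoped ContDiff

/-! ### The invariant integral of (v·l)⁻² over null directions -/

section SphereIntegral

/-- Integration in spherical coordinates. -/
theorem lintegral_spherical (f : EuclideanSpace ℝ (Fin 3) → ENNReal) (hf : Measurable f) :
    ∫⁻ x, f x = ∫⁻ n : S2, (∫⁻ r in Ioi (0 : ℝ), ENNReal.ofReal (r ^ 2) * f (r • n.1)) ∂angle := by
  have h := (volume : Measure (EuclideanSpace ℝ (Fin 3))).measurePreserving_homeomorphUnitSphereProd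
  have hd : Module.finrank ℝ (EuclideanSpace ℝ (Fin 3)) - 1 = 2 := by simp
  rw [hd] at h
  have hg : Measurable fun p : S2 × Ioi (0 : ℝ) => f (p.2.1 • p.1.1) := by fun_prop
  -- Polar coordinates exist only off the origin, which is a null set.
  calc ∫⁻ x, f x = ∫⁻ x in ({0} : Set (EuclideanSpace ℝ (Fin 3)))ᶜ, f x := by
        rw [restrict_compl_singleton]
    _ = ∫⁻ x : (({0} : Set (EuclideanSpace ℝ (Fin 3)))ᶜ : Set _), f x.1 ∂(volume.comap Subtype.val) :=
        (lintegral_subtype_comap (measurableSet_singleton _).compl f).symm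
    _ = ∫⁻ p : S2 × Ioi (0 : ℝ), f (p.2.1 • p.1.1)
          ∂(angle.prod (Measure.volumeIoiPow 2)) := by
        rw [angle, ← h.lintegral_comp hg]
        refine lintegral_congr fun x => ?_
        have hx : ‖x.1‖ ≠ 0 := norm_ne_zero_iff.mpr x.2
        simp [smul_smul, hx]
    _ = ∫⁻ n : S2, (∫⁻ r : Ioi (0 : ℝ), f (r.1 • n.1) ∂(Measure.volumeIoiPow 2)) ∂angle :=
        lintegral_prod _ hg.aemeasurable
    _ = _ := by
        refine lintegral_congr fun n => ?_
        rw [Measure.volumeIoiPow, lintegral_withDensity_eq_lintegral_mul _ (by fun_prop) (by fun_prop),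
          ← lintegral_subtype_comap measurableSet_Ioi]
        rfl

/-- Trades the inverse square for a radial integral, so that an integral over the sphere becomes a
volume integral, which may then be evaluated in coordinates adapted to the vector w. -/
theorem lintegral_radial_exp {c : ℝ} (hc : 0 < c) :
    ∫⁻ r in Ioi (0 : ℝ), ENNReal.ofReal (r * Real.exp (-(c * r))) = ENNReal.ofReal ((c ^ 2)⁻¹) := by
  have h := Real.integral_rpow_mul_exp_neg_mul_Ioi (a := 2) (r := c) two_pos hc
  have h2 : ∫ r in Ioi (0 : ℝ), r * Real.exp (-(c * r)) = (c ^ 2)⁻¹ := by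
    norm_num at h
    rw [h]
  rw [← h2, ofReal_integral_eq_lintegral_ofReal]
  -- The Bochner integral of a non-integrable function is 0 by default, so a nonzero value already
  -- proves integrability.
  · exact Integrable.of_integral_ne_zero (by rw [h2]; positivity)
  · filter_upwards [ae_restrict_mem measurableSet_Ioi] with r (hr : 0 < r)
    positivity

/-- Integration in cylindrical coordinates. -/
theorem lintegral_cylindrical (f : EuclideanSpace ℝ (Fin 3) → ENNReal) (hf : Measurable f) :
    ∫⁻ x, f x = ∫⁻ z : ℝ, ∫⁻ p in polarCoord.target,
      ENNReal.ofReal p.1 * f !₂[z, p.1 * Real.cos p.2, p.1 * Real.sin p.2] := by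
  have h1 := PiLp.volume_preserving_ofLp (Fin 3)
  have h2 := volume_preserving_piFinSuccAbove (fun _ : Fin 3 => ℝ) 0
  have h3 := (MeasurePreserving.id (volume : Measure ℝ)).prod (volume_preserving_finTwoArrow ℝ)
  have h := h3.comp (h2.comp h1)
  have hg : Measurable fun q : ℝ × ℝ × ℝ => f !₂[q.1, q.2.1, q.2.2] := by
    refine hf.comp ((WithLp.measurable_toLp 2 _).comp ?_)
    rw [measurable_pi_iff]
    intro i
    fin_cases i <;> simp <;> fun_prop
  calc ∫⁻ x, f x = ∫⁻ q : ℝ × ℝ × ℝ, f !₂[q.1, q.2.1, q.2.2] := by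
        refine Eq.trans ?_ (h.lintegral_comp hg)
        refine lintegral_congr fun x => congrArg f ?_
        ext i
        fin_cases i <;> rfl
    _ = ∫⁻ z : ℝ, ∫⁻ y : ℝ × ℝ, f !₂[z, y.1, y.2] := lintegral_prod _ hg.aemeasurable
    _ = _ := by
        refine lintegral_congr fun z => ?_
        rw [← lintegral_comp_polarCoord_symm]
        rfl

/-- With the weight 1/‖x‖ and the Jacobian ρ the integrand is the exact derivative of
-exp(-a√(z²+ρ²))/a, so only the boundary value at ρ = 0 survives. -/
theorem lintegral_cylinder_exp {a : ℝ} (ha : 0 < a) (z : ℝ) :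
    ∫⁻ ρ in Ioi (0 : ℝ), ENNReal.ofReal (ρ * (Real.exp (-(a * √(z ^ 2 + ρ ^ 2))) / √(z ^ 2 + ρ ^ 2))) =
      ENNReal.ofReal (Real.exp (-(a * |z|)) / a) := by
  have hd : ∀ ρ ∈ Ioi (0 : ℝ), HasDerivAt (fun ρ => -(Real.exp (-(a * √(z ^ 2 + ρ ^ 2))) / a))
      (ρ * (Real.exp (-(a * √(z ^ 2 + ρ ^ 2))) / √(z ^ 2 + ρ ^ 2))) ρ := by
    intro ρ (hρ : 0 < ρ)
    have h0 : z ^ 2 + ρ ^ 2 ≠ 0 := by positivity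
    have h1 := ((((hasDerivAt_pow 2 ρ).const_add (z ^ 2)).sqrt h0).const_mul a).neg.exp.div_const a |>.neg
    refine h1.congr_deriv ?_
    have : √(z ^ 2 + ρ ^ 2) ≠ 0 := by positivity
    simp only [Pi.neg_apply]
    field_simp
    push_cast
    ring
  have hn : ∀ ρ ∈ Ioi (0 : ℝ), 0 ≤ ρ * (Real.exp (-(a * √(z ^ 2 + ρ ^ 2))) / √(z ^ 2 + ρ ^ 2)) := by
    intro ρ (hρ : 0 < ρ)
    positivity
  have hc : ContinuousWithinAt (fun ρ => -(Real.exp (-(a * √(z ^ 2 + ρ ^ 2))) / a)) (Ici 0) 0 := by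
    apply Continuous.continuousWithinAt
    fun_prop
  have ht : Tendsto (fun ρ => -(Real.exp (-(a * √(z ^ 2 + ρ ^ 2))) / a)) atTop (𝓝 0) := by
    have h1 : Tendsto (fun ρ : ℝ => √(z ^ 2 + ρ ^ 2)) atTop atTop := by
      refine tendsto_atTop_mono (fun ρ => ?_) tendsto_id
      exact Real.le_sqrt_of_sq_le (by simp [sq_nonneg])
    have h2 := (Real.tendsto_exp_neg_atTop_nhds_zero.comp (h1.const_mul_atTop ha)).div_const a |>.neg
    simpa using h2
  have hi := integrableOn_Ioi_deriv_of_nonneg hc hd hn ht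
  have hv := integral_Ioi_of_hasDerivAt_of_nonneg hc hd hn ht
  have hv' : ∫ ρ in Ioi (0 : ℝ), ρ * (Real.exp (-(a * √(z ^ 2 + ρ ^ 2))) / √(z ^ 2 + ρ ^ 2)) =
      Real.exp (-(a * |z|)) / a := by
    rw [hv]; simp [Real.sqrt_sq_eq_abs]
  rw [← hv', ofReal_integral_eq_lintegral_ofReal hi]
  filter_upwards [ae_restrict_mem measurableSet_Ioi] with r hr using hn r hr

/-- The two half-lines contribute 1/(a - b) and 1/(a + b); b < a makes the first one converge. -/
theorem lintegral_exp_abs {a b : ℝ} (hb : 0 ≤ b) (hab : b < a) :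
    ∫⁻ z : ℝ, ENNReal.ofReal (Real.exp (-(a * |z|) + b * z)) =
      ENNReal.ofReal (2 * a / (a ^ 2 - b ^ 2)) := by
  have h1 : ∫ z in Ioi (0 : ℝ), Real.exp (-(a * |z|) + b * z) = (a - b)⁻¹ := by
    have := integral_exp_mul_Ioi (a := b - a) (by linarith) 0
    rw [mul_zero, Real.exp_zero] at this
    rw [← neg_sub b a, inv_neg, ← one_div, ← neg_div, ← this]
    refine setIntegral_congr_fun measurableSet_Ioi fun z (hz : 0 < z) => ?_
    simp only [abs_of_pos hz]
    ring_nf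
  have h2 : ∫ z in Iic (0 : ℝ), Real.exp (-(a * |z|) + b * z) = (a + b)⁻¹ := by
    have := integral_exp_mul_Iic (a := a + b) (by linarith) 0
    rw [mul_zero, Real.exp_zero] at this
    rw [← one_div, ← this]
    refine setIntegral_congr_fun measurableSet_Iic fun z (hz : z ≤ 0) => ?_
    simp only [abs_of_nonpos hz]
    ring_nf
  have p1 : 0 < a - b := by linarith
  have p2 : 0 < a + b := by linarith
  have i1 := Integrable.of_integral_ne_zero (h1 ▸ (inv_pos.mpr p1).ne')
  have i2 := Integrable.of_integral_ne_zero (h2 ▸ (inv_pos.mpr p2).ne')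
  have hpos : ∀ s : Set ℝ, 0 ≤ᵐ[volume.restrict s] fun z => Real.exp (-(a * |z|) + b * z) :=
    fun s => ae_of_all _ fun z => (Real.exp_pos _).le
  rw [← lintegral_add_compl _ (measurableSet_Iic (a := (0 : ℝ))), compl_Iic,
    ← ofReal_integral_eq_lintegral_ofReal i1 (hpos _), ← ofReal_integral_eq_lintegral_ofReal i2 (hpos _),
    h1, h2, ← ENNReal.ofReal_add (by positivity) (by positivity)]
  congr 1
  have : a ^ 2 - b ^ 2 ≠ 0 := by nlinarith
  field_simp
  ring

/-- The volume integral behind the sphere integral. In spherical coordinates r²/‖x‖ = r leaves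
exactly the integrand of `lintegral_radial_exp`; in cylindrical coordinates about the direction of w
everything is elementary. -/
theorem lintegral_exp_div_norm {a : ℝ} {w : EuclideanSpace ℝ (Fin 3)} (hw : ‖w‖ < a) :
    ∫⁻ x : EuclideanSpace ℝ (Fin 3), ENNReal.ofReal (Real.exp (-(a * ‖x‖) + inner ℝ w x) / ‖x‖) =
      ENNReal.ofReal (4 * Real.pi / (a ^ 2 - ‖w‖ ^ 2)) := by
  have ha : 0 < a := (norm_nonneg w).trans_lt hw
  let u : EuclideanSpace ℝ (Fin 3) := !₂[‖w‖, 0, 0]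
  have hu : ‖w‖ = ‖u‖ := by simp [u, EuclideanSpace.norm_eq, Fin.sum_univ_three]
  -- Since w and u have equal norms, the reflection in the hyperplane orthogonal to w - u carries w
  -- to u. It preserves volume, norms and inner products, so w may be taken along the first axis.
  let R := ((ℝ ∙ (w - u))ᗮ).reflection
  have hR : R w = u := Submodule.reflection_sub hu
  have hm : ∀ w : EuclideanSpace ℝ (Fin 3), Measurable fun x : EuclideanSpace ℝ (Fin 3) =>
      ENNReal.ofReal (Real.exp (-(a * ‖x‖) + inner ℝ w x) / ‖x‖) := fun w => by fun_prop
  calc _ = ∫⁻ x : EuclideanSpace ℝ (Fin 3),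
        ENNReal.ofReal (Real.exp (-(a * ‖x‖) + inner ℝ u x) / ‖x‖) := by
        rw [← R.measurePreserving.lintegral_comp (hm u)]
        simp only [← hR, LinearIsometryEquiv.inner_map_map, LinearIsometryEquiv.norm_map]
    -- The factor 2π comes from the trivial angular integration, 1/a from `lintegral_cylinder_exp`.
    _ = ∫⁻ z : ℝ, ENNReal.ofReal (2 * Real.pi / a) *
          ENNReal.ofReal (Real.exp (-(a * |z|) + ‖w‖ * z)) := by
        rw [lintegral_cylindrical _ (hm u)]
        refine lintegral_congr fun z => ?_
        have e : ∀ p ∈ polarCoord.target, ENNReal.ofReal p.1 *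
            ENNReal.ofReal (Real.exp (-(a * ‖!₂[z, p.1 * Real.cos p.2, p.1 * Real.sin p.2]‖) +
              inner ℝ u !₂[z, p.1 * Real.cos p.2, p.1 * Real.sin p.2]) /
              ‖!₂[z, p.1 * Real.cos p.2, p.1 * Real.sin p.2]‖) =
            ENNReal.ofReal (Real.exp (‖w‖ * z)) *
            ENNReal.ofReal (p.1 * (Real.exp (-(a * √(z ^ 2 + p.1 ^ 2))) / √(z ^ 2 + p.1 ^ 2))) := by
          rintro ⟨ρ, θ⟩ ⟨hρ : 0 < ρ, -⟩
          have h1 : ‖!₂[z, ρ * Real.cos θ, ρ * Real.sin θ]‖ = √(z ^ 2 + ρ ^ 2) := by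
            simp only [EuclideanSpace.norm_eq, Fin.sum_univ_three, Real.norm_eq_abs, sq_abs]
            congr 1
            simp
            linear_combination ρ ^ 2 * Real.sin_sq_add_cos_sq θ
          have h2 : inner ℝ u !₂[z, ρ * Real.cos θ, ρ * Real.sin θ] = ‖w‖ * z := by
            simp [u, PiLp.inner_apply, Fin.sum_univ_three, mul_comm]
          rw [h1, h2, ← ENNReal.ofReal_mul hρ.le, ← ENNReal.ofReal_mul (Real.exp_pos _).le,
            Real.exp_add]
          congr 1
          ring
        rw [setLIntegral_congr_fun polarCoord.open_target.measurableSet e, polarCoord_target,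
          lintegral_const_mul _ (by fun_prop), Measure.volume_eq_prod, ← Measure.prod_restrict,
          lintegral_prod _ (by fun_prop)]
        simp only [lintegral_const, Measure.restrict_apply_univ, Real.volume_Ioo]
        rw [lintegral_mul_const _ (by fun_prop), lintegral_cylinder_exp ha,
          ← ENNReal.ofReal_mul (by positivity), ← ENNReal.ofReal_mul (by positivity),
          ← ENNReal.ofReal_mul (by positivity), Real.exp_add]
        congr 1
        ring
    _ = _ := by
        rw [lintegral_const_mul _ (by fun_prop), lintegral_exp_abs (norm_nonneg w) hw,
          ← ENNReal.ofReal_mul (by positivity)]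
        congr 1
        field_simp
        ring

/-- The integral over the sphere of `(a - w · n)⁻²`. -/
theorem integral_sphere_inv_sq {a : ℝ} {w : EuclideanSpace ℝ (Fin 3)} (hw : ‖w‖ < a) :
    ∫ n : S2, ((a - inner ℝ w n.1) ^ 2)⁻¹ ∂angle = 4 * Real.pi / (a ^ 2 - ‖w‖ ^ 2) := by
  have hpos : ∀ n : S2, 0 < a - inner ℝ w n.1 := fun n => by
    have h1 := real_inner_le_norm w n.1
    have h2 : ‖n.1‖ = 1 := by simp
    rw [h2, mul_one] at h1
    linarith
  have hd : 0 < a ^ 2 - ‖w‖ ^ 2 := by nlinarith [norm_nonneg w]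
  have hm : Measurable fun n : S2 => ((a - inner ℝ w n.1) ^ 2)⁻¹ := by fun_prop
  rw [integral_eq_lintegral_of_nonneg_ae (ae_of_all _ fun n => by positivity)
    hm.aestronglyMeasurable]
  -- The same volume integral is now read in spherical coordinates, where its radial part is (a -
  -- w·n)⁻².
  have h := lintegral_exp_div_norm hw
  rw [lintegral_spherical _ (by fun_prop)] at h
  have e : ∀ n : S2, (∫⁻ r in Ioi (0 : ℝ), ENNReal.ofReal (r ^ 2) *
      ENNReal.ofReal (Real.exp (-(a * ‖r • n.1‖) + inner ℝ w (r • n.1)) / ‖r • n.1‖)) =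
      ENNReal.ofReal ((a - inner ℝ w n.1) ^ 2)⁻¹ := fun n => by
    rw [← lintegral_radial_exp (hpos n)]
    refine setLIntegral_congr_fun measurableSet_Ioi fun r (hr : 0 < r) => ?_
    have h2 : ‖n.1‖ = 1 := by simp
    rw [← ENNReal.ofReal_mul (by positivity), norm_smul, h2, mul_one, Real.norm_of_nonneg hr.le,
      inner_smul_right]
    congr 1
    field_simp
    congr 1
    ring
  simp only [e] at h
  rw [h, ENNReal.toReal_ofReal (by have := Real.pi_pos; positivity)]

/-- The invariant integral of `(v · l)⁻²` over null directions. -/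
theorem integral_inv_mink_sq (v : Hyperboloid) :
    ∫ n, (mink v.1 (ray n) ^ 2)⁻¹ ∂angle = 4 * Real.pi := by
  obtain ⟨hv, hv0⟩ := v.2
  rw [mink_expand] at hv
  let w : EuclideanSpace ℝ (Fin 3) := !₂[v.1 1, v.1 2, v.1 3]
  -- This makes the denominator a² - ‖w‖² equal to v·v = 1, so that the integral does not depend on
  -- v.
  have hw : ‖w‖ ^ 2 = v.1 0 ^ 2 - 1 := by
    rw [EuclideanSpace.norm_sq_eq, Fin.sum_univ_three]
    simp [w]
    linarith
  have hlt : ‖w‖ < v.1 0 := lt_of_pow_lt_pow_left₀ 2 hv0.le (by linarith)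
  have h := integral_sphere_inv_sq hlt
  have e : ∀ n : S2, mink v.1 (ray n) = v.1 0 - inner ℝ w n.1 := fun n => by
    simp [mink_expand, ray, w, PiLp.inner_apply, Fin.sum_univ_three]
    ring
  simp only [e]
  rw [h, hw]
  simp

end SphereIntegral

/-! ### The constant gauge elements and their commutation with B(g) -/

section GaugeRelations
variable {e : ℝ}

theorem constGauge_add (c d : ℝ) : constGauge (c + d) = constGauge c + constGauge d := by
  refine Subtype.ext (funext fun s => funext fun l => ?_)
  change constGaugeFun (c + d) s l = constGaugeFun c s l + constGaugeFun d s l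
  by_cases hl : l ∈ lightCone
  · rw [constGaugeFun_of_mem _ _ hl, constGaugeFun_of_mem _ _ hl, constGaugeFun_of_mem _ _ hl,
      ← add_smul]
    congr 1
    ring
  · simp [constGaugeFun, hl]

theorem constGauge_zero : constGauge 0 = 0 := by
  have h := constGauge_add 0 0
  rw [add_zero] at h
  exact left_eq_add.mp h

theorem constGauge_neg (c : ℝ) : constGauge (-c) = -constGauge c :=
  eq_neg_of_add_eq_zero_left (by rw [← constGauge_add, neg_add_cancel, constGauge_zero])

theorem dotV_constGaugeFun (c s : ℝ) {l : Spacetime} (hl : l ∈ lightCone) :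
    dotV (constGaugeFun c) s l = deriv (fun u => c * step (u / l 0) / l 0 ^ 2) s • l := by
  have e : (fun u => constGaugeFun c u l) = fun u => (c * step (u / l 0) / l 0 ^ 2) • l :=
    funext fun u => constGaugeFun_of_mem c u hl
  have hd : DifferentiableAt ℝ (fun u => c * step (u / l 0) / l 0 ^ 2) s := by
    have := contDiff_step.differentiable (by simp)
    fun_prop
  rw [dotV, e, deriv_smul_const hd]

/-- Both the field and its s-derivative are proportional to l, and l·l = 0. This removes the phase
in the Weyl relation, so the gauge elements form a genuine one-parameter group. -/
theorem sympl_constGauge (c d : ℝ) : sympl (constGauge c).1 (constGauge d).1 = 0 := by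
  have : ∀ p : ℝ × S2, mink (dotV (constGauge c).1 p.1 (ray p.2)) ((constGauge d).1 p.1 (ray p.2)) -
      mink (dotV (constGauge d).1 p.1 (ray p.2)) ((constGauge c).1 p.1 (ray p.2)) = 0 := fun p => by
    have h := ray_mem p.2
    simp only [constGauge, dotV_constGaugeFun _ _ h, constGaugeFun_of_mem _ _ h, mink_smul_left,
      mink_smul_right, h.1, mul_zero, sub_zero]
  simp only [sympl, this, integral_zero, mul_zero]

/-- The source of charge quantization: the identification of test fields makes the gauge group
periodic. -/
theorem cls_constGauge_period (e : ℝ) : cls e (constGauge (2 * Real.pi / e)) = 0 := by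
  refine (QuotientAddGroup.eq_zero_iff _).mpr ?_
  -- On l = (1, n) the limit is the constant 2π/e, so its normalized angular mean is the period
  -- itself and the integer is 1.
  refine ⟨fun s l => 2 * Real.pi / e * step (s / l 0) / l 0 ^ 2,
    fun l => 2 * Real.pi / e / l 0 ^ 2, fun s l hl => constGaugeFun_of_mem _ s hl, fun l hl => ?_,
    1, ?_⟩
  · refine tendsto_const_nhds.congr' ?_
    filter_upwards [eventually_le_atBot (-l 0)] with s hs
    rw [step_of_le, mul_one]
    rw [div_le_iff₀ hl.2]
    linarith
  · simp only [ray_zero, one_pow, div_one, integral_const, angle_univ, smul_eq_mul, Int.cast_one,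
      one_mul]
    have := Real.pi_ne_zero
    field_simp

/-- Since Φ is constant, the value 4π of the sphere integral cancels the normalization, and the
phase loses its dependence on v. This is what turns S_Φ into a scalar. -/
theorem phase_constGauge (e c : ℝ) (v : Hyperboloid) :
    phase e (constGauge c).1 v = Complex.exp ((e * c : ℝ) * Complex.I) := by
  have h : ∫ n, Phi (constGauge c).1 (ray n) / mink v.1 (ray n) ^ 2 ∂angle = c * (4 * Real.pi) := by
    simp only [Phi_constGauge c (ray_mem _), div_eq_mul_inv]
    rw [integral_const_mul, integral_inv_mink_sq]
  rw [phase, h]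
  congr 3
  have := Real.pi_ne_zero
  field_simp

theorem twist_constGauge (e c : ℝ) (g : OneParticle) :
    twist e (constGauge c) g = Complex.exp ((e * c : ℝ) * Complex.I) • g := by
  refine Subtype.ext (AEEqFun.ext ?_)
  refine (AEEqFun.coeFn_mk _ _).trans ?_
  simp only [phase_constGauge]
  exact (AEEqFun.coeFn_smul (𝕜 := ℂ) (Complex.exp ((e * c : ℝ) * Complex.I)) g.1).symm

theorem Weyl_zero (e : ℝ) : Weyl e 0 = 1 := by
  rw [Weyl, PreField.weyl, PreField.mk_rel Rel.weyl_zero, map_one, map_one]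

theorem gaugeWeyl_add (e c d : ℝ) : gaugeWeyl e (c + d) = gaugeWeyl e c * gaugeWeyl e d := by
  have h := PreField.mk_rel (Rel.weyl_mul (e := e) (constGauge c) (constGauge d))
  rw [sympl_constGauge] at h
  simp only [Complex.ofReal_zero, mul_zero, Complex.exp_zero, one_smul, map_mul] at h
  have h2 : cls e (constGauge (c + d)) = cls e (constGauge c) + cls e (constGauge d) := by
    rw [constGauge_add]; rfl
  rw [gaugeWeyl, gaugeWeyl, gaugeWeyl, Weyl, Weyl, Weyl, ← map_mul, h2]
  exact congrArg CStarCompletion.of h.symm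

theorem gaugeWeyl_zero (e : ℝ) : gaugeWeyl e 0 = 1 := by
  rw [gaugeWeyl, constGauge_zero]
  exact Weyl_zero e

theorem gaugeWeyl_period (e : ℝ) : gaugeWeyl e (2 * Real.pi / e) = 1 := by
  rw [gaugeWeyl, cls_constGauge_period, Weyl_zero]

theorem star_gaugeWeyl (e c : ℝ) : star (gaugeWeyl e c) = gaugeWeyl e (-c) := by
  rw [gaugeWeyl, gaugeWeyl, constGauge_neg, Weyl, Weyl, PreField.weyl, ← map_star, ← PreField.mk_star,
    PreField.mk_rel (Rel.weyl_star _)]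
  rfl

/-- Antilinearity of B conjugates the phase of the twisted argument, which fixes the sign: B(g)
lowers the charge by e. -/
theorem gaugeWeyl_mul_B (e c : ℝ) (g : OneParticle) :
    gaugeWeyl e c * B e g = Complex.exp ((-(e * c) : ℝ) * Complex.I) • (B e g * gaugeWeyl e c) := by
  have h := PreField.mk_rel (Rel.weyl_ferm (e := e) (constGauge c) g)
  rw [map_mul, map_mul, twist_constGauge, PreField.mk_rel (Rel.ferm_smul _ _), map_smul,
    smul_mul_assoc] at h
  have h2 : star (Complex.exp ((e * c : ℝ) * Complex.I)) =
      Complex.exp ((-(e * c) : ℝ) * Complex.I) := by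
    rw [Complex.star_def, ← Complex.exp_conj]
    simp
  rw [h2] at h
  have h3 := congrArg CStarCompletion.of h
  rwa [map_smul, map_mul, map_mul] at h3

/-- The adjoint of the relation for B(g) at -c; B(g)* raises the charge by e. -/
theorem gaugeWeyl_mul_star_B (e c : ℝ) (g : OneParticle) :
    gaugeWeyl e c * star (B e g) =
      Complex.exp ((e * c : ℝ) * Complex.I) • (star (B e g) * gaugeWeyl e c) := by
  have h := congrArg star (gaugeWeyl_mul_B e (-c) g)
  rw [star_mul, star_smul, star_mul, star_gaugeWeyl, neg_neg] at h
  have h2 : star (Complex.exp ((-(e * -c) : ℝ) * Complex.I)) * Complex.exp ((e * c : ℝ) * Complex.I) = 1 := by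
    rw [Complex.star_def, ← Complex.exp_conj, ← Complex.exp_add]
    simp
  rw [h, smul_smul, mul_comm, h2, one_smul]

end GaugeRelations

/-! ### Charge sectors, their shifts and their existence -/

section ChargeSectors

variable {e : ℝ} {H : Type*} [NormedAddCommGroup H] [InnerProductSpace ℂ H] [CompleteSpace H]
  (π : FieldAlgebra e →⋆ₐ[ℂ] (H →L[ℂ] H))

/-- The vectors on which the gauge group acts by the character `c ↦ exp (i q c)`. -/
def chargeSector (q : ℝ) : Submodule ℂ H where
  carrier := {ψ | ∀ c : ℝ, π (gaugeWeyl e c) ψ = Complex.exp ((q * c : ℝ) * Complex.I) • ψ}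
  zero_mem' c := by simp
  add_mem' := fun {ψ φ} hψ hφ c => by rw [map_add, hψ c, hφ c, smul_add]
  smul_mem' := fun z ψ hψ c => by rw [map_smul, hψ c, smul_comm]

/-- Differentiating the character at c = 0 gives iq, which -i turns into q. Only this inclusion is
needed: nonzero vectors are produced in sectors, and the sectors then show that eigenspaces are
nonzero and large enough to be cyclic. -/
theorem chargeSector_le_chargeEigenspace (q : ℝ) : chargeSector π q ≤ chargeEigenspace π q := by
  intro ψ hψ
  have h0 : HasDerivAt (fun c : ℝ => Complex.exp ((q * c : ℝ) * Complex.I)) (q * Complex.I) 0 := by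
    have h1 : HasDerivAt (fun c : ℝ => ((q * c : ℝ) : ℂ) * Complex.I) (q * Complex.I) 0 := by
      have := ((hasDerivAt_id (0 : ℝ)).const_mul q).ofReal_comp.mul_const Complex.I
      simpa using this
    simpa using h1.cexp
  have h2 : HasDerivAt (fun c : ℝ => π (gaugeWeyl e c) ψ) ((q * Complex.I) • ψ) 0 := by
    have e1 : (fun c : ℝ => π (gaugeWeyl e c) ψ) =
        fun c : ℝ => Complex.exp ((q * c : ℝ) * Complex.I) • ψ := funext hψ
    rw [e1]
    exact h0.smul_const ψ
  refine ⟨h2.differentiableAt, ?_⟩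
  change -Complex.I • deriv (fun c : ℝ => π (gaugeWeyl e c) ψ) 0 = _
  rw [h2.deriv, smul_smul]
  congr 1
  linear_combination -(q : ℂ) * Complex.I_sq

variable {π}

theorem B_apply_mem_chargeSector {q : ℝ} {ψ : H} (hψ : ψ ∈ chargeSector π q) (g : OneParticle) :
    π (B e g) ψ ∈ chargeSector π (q - e) := by
  intro c
  have h := congrArg (fun a => π a ψ) (gaugeWeyl_mul_B e c g)
  simp only [map_mul, map_smul] at h
  change π (gaugeWeyl e c) (π (B e g) ψ) = (_ : ℂ) • π (B e g) (π (gaugeWeyl e c) ψ) at h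
  rw [h, hψ c, map_smul, smul_smul, ← Complex.exp_add]
  congr 2
  push_cast
  ring

theorem star_B_apply_mem_chargeSector {q : ℝ} {ψ : H} (hψ : ψ ∈ chargeSector π q) (g : OneParticle) :
    π (star (B e g)) ψ ∈ chargeSector π (q + e) := by
  intro c
  have h := congrArg (fun a => π a ψ) (gaugeWeyl_mul_star_B e c g)
  simp only [map_mul, map_smul] at h
  change π (gaugeWeyl e c) (π (star (B e g)) ψ) = (_ : ℂ) • π (star (B e g)) (π (gaugeWeyl e c) ψ) at h
  rw [h, hψ c, map_smul, smul_smul, ← Complex.exp_add]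
  congr 2
  push_cast
  ring

/-- If the lower sector were zero, every B(g) would annihilate the whole sector q. -/
theorem chargeSector_sub_ne_bot (hN : annihilatedByB π = ⊥) {q : ℝ} (h : chargeSector π q ≠ ⊥) :
    chargeSector π (q - e) ≠ ⊥ := by
  intro h0
  obtain ⟨ψ, hψ, hne⟩ := Submodule.exists_mem_ne_zero_of_ne_bot h
  have : ψ ∈ annihilatedByB π := by
    rw [annihilatedByB, Submodule.mem_iInf]
    intro g
    have := B_apply_mem_chargeSector hψ g
    rwa [h0, Submodule.mem_bot] at this
  rw [hN, Submodule.mem_bot] at this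
  exact hne this

/-- The mirror image of the previous argument, with every B(g)* annihilating the sector q. -/
theorem chargeSector_add_ne_bot (hN : annihilatedByBStar π = ⊥) {q : ℝ} (h : chargeSector π q ≠ ⊥) :
    chargeSector π (q + e) ≠ ⊥ := by
  intro h0
  obtain ⟨ψ, hψ, hne⟩ := Submodule.exists_mem_ne_zero_of_ne_bot h
  have : ψ ∈ annihilatedByBStar π := by
    rw [annihilatedByBStar, Submodule.mem_iInf]
    intro g
    have := star_B_apply_mem_chargeSector hψ g
    rwa [h0, Submodule.mem_bot] at this
  rw [hN, Submodule.mem_bot] at this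
  exact hne this

/-- If all coefficients vanish they are summable, so the Fourier series converges to f; but its sum
is 0. -/
theorem exists_fourierCoeff_ne_zero {T : ℝ} [Fact (0 < T)] {f : C(AddCircle T, ℂ)} (hf : f ≠ 0) :
    ∃ k, fourierCoeff f k ≠ 0 := by
  by_contra! h
  have hz : fourierCoeff f = 0 := funext h
  have hs := hasSum_fourier_series_of_summable (f := f) (by rw [hz]; exact summable_zero)
  rw [hz] at hs
  simp only [Pi.zero_apply, zero_smul] at hs
  exact hf (hs.unique hasSum_zero)

/-- The spectrum of the charge operator consists of eigenvalues in `e ℤ`: some sector is nonzero. -/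
theorem exists_chargeSector_ne_bot (he : e ≠ 0) (hπ : IsChargeRep π) [Nontrivial H] :
    ∃ k : ℤ, chargeSector π (k * e) ≠ ⊥ := by
  obtain ⟨ψ, hψ⟩ := exists_ne (0 : H)
  -- The sign of e is arbitrary, while a circle needs a positive length.
  set T : ℝ := |2 * Real.pi / e| with hT
  have hpos : 0 < T := abs_pos.mpr (div_ne_zero (by positivity) he)
  have : Fact (0 < T) := ⟨hpos⟩
  have hper1 : gaugeWeyl e T = 1 := by
    rcases abs_choice (2 * Real.pi / e) with h | h
    · rw [hT, h, gaugeWeyl_period]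
    · rw [hT, h, ← star_gaugeWeyl, gaugeWeyl_period, star_one]
  have hper : Function.Periodic (fun c : ℝ => π (gaugeWeyl e c) ψ) T := fun c => by
    simp only [gaugeWeyl_add, hper1, mul_one]
  let F : AddCircle T → H := hper.lift
  have hF : Continuous F := continuous_quot_lift _ (hπ ψ)
  have hshift : ∀ (d : ℝ) (t : AddCircle T), π (gaugeWeyl e d) (F t) = F (t + (d : AddCircle T)) := by
    intro d t
    induction t using QuotientAddGroup.induction_on with
    | H c =>
      change π (gaugeWeyl e d) (π (gaugeWeyl e c) ψ) = π (gaugeWeyl e (c + d)) ψ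
      rw [add_comm, gaugeWeyl_add, map_mul]
      rfl
  have hint : ∀ k : ℤ, Integrable (fun t => fourier (-k) t • F t) AddCircle.haarAddCircle := fun k =>
    (((fourier (-k)).continuous.smul hF)).integrable_of_hasCompactSupport (HasCompactSupport.of_compactSpace _)
  -- The Fourier coefficients of the orbit are vectors in H. Translation invariance of Haar measure
  -- shows that the gauge group acts on the k-th one by the k-th character.
  have hmem : ∀ k : ℤ, ∀ d : ℝ, π (gaugeWeyl e d) (fourierCoeff F k) =
      fourier k (d : AddCircle T) • fourierCoeff F k := by
    intro k d
    have h1 : ∀ t : AddCircle T, fourier (-k) t =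
        fourier k (d : AddCircle T) * fourier (-k) (t + (d : AddCircle T)) := fun t => by
      have h2 : fourier k (t + (d : AddCircle T)) = fourier k t * fourier k (d : AddCircle T) := by
        simp only [fourier_apply, smul_add, AddCircle.toCircle_add, Circle.coe_mul]
      have h3 : ‖fourier k (d : AddCircle T)‖ = 1 := by
        rw [fourier_apply]
        exact Circle.norm_coe _
      rw [fourier_neg, fourier_neg, h2, map_mul, mul_left_comm, Complex.mul_conj,
        Complex.normSq_eq_norm_sq, h3]
      simp
    calc π (gaugeWeyl e d) (fourierCoeff F k)
        = ∫ t, fourier k (d : AddCircle T) • (fourier (-k) (t + (d : AddCircle T)) •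
            F (t + (d : AddCircle T))) ∂AddCircle.haarAddCircle := by
          rw [fourierCoeff, ← ContinuousLinearMap.integral_comp_comm _ (hint k)]
          refine integral_congr_ae (ae_of_all _ fun t => ?_)
          simp only [map_smul, hshift, smul_smul, ← h1]
      _ = _ := by
          rw [integral_add_right_eq_self (fun t => fourier k (d : AddCircle T) •
            (fourier (-k) t • F t)) (d : AddCircle T), integral_smul, fourierCoeff]
  -- Nonvanishing is tested on a scalar matrix element, whose value at 0 is ‖ψ‖². Its Fourier
  -- coefficients are the inner products of ψ with those of the orbit.
  let f : C(AddCircle T, ℂ) := ⟨fun t => inner ℂ ψ (F t), continuous_const.inner hF⟩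
  have hf : f ≠ 0 := by
    intro h
    have h0 := DFunLike.congr_fun h ((0 : ℝ) : AddCircle T)
    change inner ℂ ψ (π (gaugeWeyl e 0) ψ) = 0 at h0
    rw [gaugeWeyl_zero, map_one] at h0
    exact hψ (inner_self_eq_zero.mp h0)
  obtain ⟨k, hk⟩ := exists_fourierCoeff_ne_zero hf
  have hk2 : fourierCoeff F k ≠ 0 := by
    intro h
    apply hk
    have h1 := ContinuousLinearMap.integral_comp_comm (innerSL ℂ ψ) (hint k)
    rw [fourierCoeff] at h ⊢
    rw [h, map_zero] at h1
    rw [← h1]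
    refine integral_congr_ae (ae_of_all _ fun t => ?_)
    simp [f]
  -- The k-th character has frequency 2πk/T, and 2π/T = |e|.
  have key : fourierCoeff F k ∈ chargeSector π (k * |e|) := by
    intro d
    rw [hmem k d, fourier_coe_apply]
    congr 2
    rw [hT, abs_div, abs_of_pos (by positivity : 0 < 2 * Real.pi)]
    have := Real.pi_ne_zero
    have : |e| ≠ 0 := abs_ne_zero.mpr he
    push_cast
    have : ((|e| : ℝ) : ℂ) ≠ 0 := by exact_mod_cast this
    field_simp
  have hne : chargeSector π (k * |e|) ≠ ⊥ := fun h => hk2 (by rwa [h, Submodule.mem_bot] at key)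
  -- For negative e the absolute value is absorbed by replacing k with -k.
  rcases abs_choice e with h | h
  · exact ⟨k, by rwa [h] at hne⟩
  · refine ⟨-k, ?_⟩
    rw [h] at hne
    push_cast
    rwa [neg_mul, ← mul_neg]

/-- From one occupied charge, B(g)* leads upwards and B(g) downwards through all of eℤ, hence the
two-sided induction starting at m. -/
theorem chargeSector_ne_bot (he : e ≠ 0) (hπ : IsChargeRep π) [Nontrivial H]
    (hN : annihilatedByB π = ⊥) (hN' : annihilatedByBStar π = ⊥) (k : ℤ) :
    chargeSector π (k * e) ≠ ⊥ := by
  obtain ⟨m, hm⟩ := exists_chargeSector_ne_bot he hπ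
  induction k using Int.inductionOn' (b := m) with
  | zero => exact hm
  | succ k _ ih =>
    have := chargeSector_add_ne_bot hN' ih
    push_cast
    rwa [add_mul, one_mul]
  | pred k _ ih =>
    have := chargeSector_sub_ne_bot hN ih
    push_cast
    rwa [sub_mul, one_mul]

end ChargeSectors

/-! ### Generated invariant subspaces and cyclicity -/

section InvariantSubspaces

variable {e : ℝ} {H : Type*} [NormedAddCommGroup H] [InnerProductSpace ℂ H] [CompleteSpace H]
  {π : FieldAlgebra e →⋆ₐ[ℂ] (H →L[ℂ] H)}

theorem mem_annihilatedByB {ψ : H} : ψ ∈ annihilatedByB π ↔ ∀ g, π (B e g) ψ = 0 := by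
  rw [annihilatedByB, Submodule.mem_iInf]; rfl

theorem mem_annihilatedByBStar {ψ : H} :
    ψ ∈ annihilatedByBStar π ↔ ∀ g, π (star (B e g)) ψ = 0 := by
  rw [annihilatedByBStar, Submodule.mem_iInf]; rfl

namespace InvariantSubspace

/-- The closed invariant subspace generated by a subspace. -/
def generated (π : FieldAlgebra e →⋆ₐ[ℂ] (H →L[ℂ] H)) (S : Submodule ℂ H) : InvariantSubspace π where
  space := (Submodule.span ℂ
    {φ | ∃ (a : FieldAlgebra e) (ψ : H), ψ ∈ S ∧ φ = π a ψ}).topologicalClosure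
  isClosed := Submodule.isClosed_topologicalClosure _
  invariant a ψ hψ := by
    refine map_mem_closure (π a).continuous hψ fun φ hφ => ?_
    induction hφ using Submodule.span_induction with
    | mem φ h =>
      obtain ⟨b, χ, hχ, rfl⟩ := h
      refine Submodule.subset_span ⟨a * b, χ, hχ, ?_⟩
      rw [map_mul]; rfl
    | zero => rw [map_zero]; exact Submodule.zero_mem _
    | add φ χ _ _ h1 h2 => rw [map_add]; exact Submodule.add_mem _ h1 h2
    | smul c φ _ h => rw [map_smul]; exact Submodule.smul_mem _ c h

theorem apply_mem_generated {S : Submodule ℂ H} (a : FieldAlgebra e) {ψ : H} (hψ : ψ ∈ S) :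
    π a ψ ∈ (generated π S).space :=
  Submodule.le_topologicalClosure _ (Submodule.subset_span ⟨a, ψ, hψ, rfl⟩)

theorem le_generated (S : Submodule ℂ H) : S ≤ (generated π S).space := fun ψ hψ => by
  simpa using apply_mem_generated (π := π) 1 hψ

theorem generated_le {S : Submodule ℂ H} {M : InvariantSubspace π} (h : S ≤ M.space) :
    (generated π S).space ≤ M.space := by
  refine Submodule.topologicalClosure_minimal _ (Submodule.span_le.mpr ?_) M.isClosed
  rintro _ ⟨a, ψ, hψ, rfl⟩
  exact M.invariant a ψ (h hψ)

/-- The orthogonal complement of an invariant subspace. -/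
def orthogonal (M : InvariantSubspace π) : InvariantSubspace π where
  space := M.spaceᗮ
  isClosed := Submodule.isClosed_orthogonal _
  invariant a ψ hψ := by
    rw [Submodule.mem_orthogonal] at hψ ⊢
    intro φ hφ
    -- Invariance of the complement uses that the representation respects the involution: π(a) is
    -- moved to the other side as π(a*).
    have h := hψ _ (M.invariant (star a) φ hφ)
    rwa [map_star, ContinuousLinearMap.star_eq_adjoint, ContinuousLinearMap.adjoint_inner_left] at h

/-- The intersection of two invariant subspaces. -/
def inter (M N : InvariantSubspace π) : InvariantSubspace π where
  space := M.space ⊓ N.space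
  isClosed := M.isClosed.inter N.isClosed
  invariant a ψ hψ := ⟨M.invariant a ψ hψ.1, N.invariant a ψ hψ.2⟩

theorem isChargeRep_restrict (hπ : IsChargeRep π) (M : InvariantSubspace π) :
    IsChargeRep M.restrict := fun ψ => (hπ ψ).subtype_mk _

theorem coe_mem_annihilatedByB {M : InvariantSubspace π} {ψ : M.space} :
    ψ ∈ annihilatedByB M.restrict ↔ (ψ : H) ∈ annihilatedByB π := by
  simp only [mem_annihilatedByB, Subtype.ext_iff, restrict_apply, Submodule.coe_zero]

theorem coe_mem_annihilatedByBStar {M : InvariantSubspace π} {ψ : M.space} :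
    ψ ∈ annihilatedByBStar M.restrict ↔ (ψ : H) ∈ annihilatedByBStar π := by
  simp only [mem_annihilatedByBStar, Subtype.ext_iff, restrict_apply, Submodule.coe_zero]

theorem coe_mem_chargeSector {M : InvariantSubspace π} {q : ℝ} {ψ : M.space} :
    ψ ∈ chargeSector M.restrict q ↔ (ψ : H) ∈ chargeSector π q :=
  forall_congr' fun _ => Subtype.ext_iff

/-- Cyclicity for the restricted representation, whose closure is taken inside the generated
subspace. A vector there that is orthogonal to all π(a)S' is orthogonal to the generators of the
subspace containing it, hence to itself. An S' meeting this condition contains every vector of S,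
which lets the annihilated vectors be recomputed in the restriction. -/
theorem isCyclicSubspace_restrict_generated {S : Submodule ℂ H}
    {S' : Submodule ℂ (generated π S).space}
    (h : ∀ ψ : (generated π S).space, (ψ : H) ∈ S → ψ ∈ S') :
    IsCyclicSubspace (generated π S).restrict S' := by
  rw [IsCyclicSubspace, Submodule.topologicalClosure_eq_top_iff, Submodule.eq_bot_iff]
  intro y hy
  rw [Submodule.mem_orthogonal] at hy
  have hperp : (y : H) ∈ (generated π S).spaceᗮ := by
    change (y : H) ∈ (Submodule.topologicalClosure _)ᗮ
    rw [Submodule.orthogonal_closure, Submodule.mem_orthogonal]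
    intro φ hφ
    induction hφ using Submodule.span_induction with
    | mem φ hφ =>
      obtain ⟨a, ψ, hψ, rfl⟩ := hφ
      exact hy _ (Submodule.subset_span ⟨a, ⟨ψ, le_generated S hψ⟩, h _ hψ, rfl⟩)
    | zero => exact inner_zero_left _
    | add φ χ _ _ h1 h2 => rw [inner_add_left, h1, h2, add_zero]
    | smul c φ _ h => rw [inner_smul_left, h, mul_zero]
  have := Submodule.inner_right_of_mem_orthogonal y.2 hperp
  exact Subtype.ext (inner_self_eq_zero.mp this)

end InvariantSubspace

open InvariantSubspace

/-- Without vectors annihilated by all `B (g)` or by all `B (g)*`, every charge occurs and every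
charge eigenspace is cyclic. -/
theorem isFullChargeType (he : e ≠ 0) (hπ : IsChargeRep π) [Nontrivial H]
    (hN : annihilatedByB π = ⊥) (hN' : annihilatedByBStar π = ⊥) : IsFullChargeType π := by
  intro k
  have hle := chargeSector_le_chargeEigenspace π (k * e)
  refine ⟨fun h => chargeSector_ne_bot he hπ hN hN' k (le_bot_iff.mp (h ▸ hle)), ?_⟩
  -- For cyclicity the existence result is applied a second time, to the orthogonal complement Y of
  -- what S generates. The annihilated vectors of Y are annihilated in H, so Y inherits both
  -- triviality hypotheses.
  set S := chargeEigenspace π (k * e)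
  let M := generated π S
  have hM : M.spaceᗮ = ⊥ := by
    by_contra hne
    let Y := M.orthogonal
    have : Nontrivial Y.space := Submodule.nontrivial_iff_ne_bot.mpr hne
    have h1 : annihilatedByB Y.restrict = ⊥ := (Submodule.eq_bot_iff _).mpr fun y hy => by
      rw [coe_mem_annihilatedByB, hN, Submodule.mem_bot] at hy
      exact Subtype.ext hy
    have h2 : annihilatedByBStar Y.restrict = ⊥ := (Submodule.eq_bot_iff _).mpr fun y hy => by
      rw [coe_mem_annihilatedByBStar, hN', Submodule.mem_bot] at hy
      exact Subtype.ext hy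
    obtain ⟨y, hy, hy0⟩ := Submodule.exists_mem_ne_zero_of_ne_bot
      (chargeSector_ne_bot he (isChargeRep_restrict hπ Y) h1 h2 k)
    -- A vector of charge ke in the complement already belongs to S, hence to M; being also
    -- orthogonal to M, it vanishes.
    have hyM : (y : H) ∈ M.space := le_generated S (hle (coe_mem_chargeSector.mp hy))
    exact hy0 (Subtype.ext (inner_self_eq_zero.mp (Submodule.inner_right_of_mem_orthogonal hyM y.2)))
  rw [IsCyclicSubspace, Submodule.topologicalClosure_eq_top_iff, ← Submodule.orthogonal_closure]
  exact hM

end InvariantSubspaces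

end
end AsympField

/-! ### Assembly of the decomposition -/

open AsympField in
theorem proposition4p1 (e : ℝ) (he : e ≠ 0) {H : Type*} [NormedAddCommGroup H]
    [InnerProductSpace ℂ H] [CompleteSpace H]
    (π : FieldAlgebra e →⋆ₐ[ℂ] (H →L[ℂ] H)) (hπ : IsChargeRep π) :
    ∃ M₁ M₂ M₃ : InvariantSubspace π,
      M₁.space ⟂ M₂.space ∧ M₁.space ⟂ M₃.space ∧ M₂.space ⟂ M₃.space ∧
      M₁.space ⊔ M₂.space ⊔ M₃.space = ⊤ ∧
      (M₁.space = ⊥ ∨ IsFullChargeType M₁.restrict) ∧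
      IsCyclicSubspace M₂.restrict (annihilatedByB M₂.restrict) ∧
      IsCyclicSubspace M₃.restrict (annihilatedByBStar M₃.restrict) := by
  let M₂ := InvariantSubspace.generated π (annihilatedByB π)
  -- Restricting the generators to the complement of M₂ is what makes M₃ orthogonal to M₂: that
  -- complement is closed and invariant, so it contains everything they generate.
  let M₃ := InvariantSubspace.generated π (annihilatedByBStar π ⊓ M₂.orthogonal.space)
  let M₁ := M₂.orthogonal.inter M₃.orthogonal
  have h23 : M₃.space ≤ M₂.spaceᗮ :=
    InvariantSubspace.generated_le (M := M₂.orthogonal) inf_le_right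
  refine ⟨M₁, M₂, M₃, ?_, ?_, ?_, ?_, ?_, ?_, ?_⟩
  · exact Submodule.isOrtho_iff_le.mpr inf_le_left
  · exact Submodule.isOrtho_iff_le.mpr inf_le_right
  · exact (Submodule.isOrtho_iff_le.mpr h23).symm
  · rw [eq_top_iff]
    intro ψ _
    obtain ⟨x, hx, r, hr, rfl⟩ := M₂.space.exists_add_mem_mem_orthogonal ψ
    obtain ⟨y, hy, z, hz, rfl⟩ := M₃.space.exists_add_mem_mem_orthogonal r
    -- The remainder z is the difference of two vectors orthogonal to M₂, so it lies in both
    -- complements, that is, in M₁.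
    have hz2 : z ∈ M₂.spaceᗮ := by
      have := Submodule.sub_mem _ hr (h23 hy)
      rwa [add_sub_cancel_left] at this
    refine Submodule.add_mem _ ?_ (Submodule.add_mem _ ?_ ?_)
    · exact Submodule.mem_sup_left (Submodule.mem_sup_right hx)
    · exact Submodule.mem_sup_right hy
    · exact Submodule.mem_sup_left (Submodule.mem_sup_left ⟨hz2, hz⟩)
  · refine or_iff_not_imp_left.mpr fun hne => ?_
    have : Nontrivial M₁.space := Submodule.nontrivial_iff_ne_bot.mpr hne
    refine isFullChargeType he (InvariantSubspace.isChargeRep_restrict hπ M₁) ?_ ?_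
    -- A vector of M₁ annihilated by all B(g) is among the generators of M₂, to which M₁ is
    -- orthogonal.
    · refine (Submodule.eq_bot_iff _).mpr fun ψ hψ => Subtype.ext ((inner_self_eq_zero (𝕜 := ℂ)).mp ?_)
      exact Submodule.inner_right_of_mem_orthogonal
        (InvariantSubspace.le_generated (annihilatedByB π) (InvariantSubspace.coe_mem_annihilatedByB.mp hψ)) ψ.2.1
    -- A vector of M₁ annihilated by all B(g)* also lies in the complement of M₂, so it is among the
    -- generators of M₃, to which M₁ is orthogonal.
    · refine (Submodule.eq_bot_iff _).mpr fun ψ hψ => Subtype.ext ((inner_self_eq_zero (𝕜 := ℂ)).mp ?_)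
      exact Submodule.inner_right_of_mem_orthogonal (InvariantSubspace.le_generated
        (annihilatedByBStar π ⊓ M₂.orthogonal.space) ⟨InvariantSubspace.coe_mem_annihilatedByBStar.mp hψ, ψ.2.1⟩) ψ.2.2
  · exact InvariantSubspace.isCyclicSubspace_restrict_generated fun ψ hψ =>
      InvariantSubspace.coe_mem_annihilatedByB.mpr hψ
  · exact InvariantSubspace.isCyclicSubspace_restrict_generated fun ψ hψ =>
      InvariantSubspace.coe_mem_annihilatedByBStar.mpr hψ.1
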